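/- All matroids are on the ground set $[n]=\{1,\dots,n\}$. For a matroid $M$ let $Q(M)\subset\mathbb R^n$ be its base polytope, i.e. the convex hull of the incidence vectors of the bases of $M$; let $\Delta_j$ denote a simplex with $j$ vertices (of dimension $j-1$). For a polytope $Q$ whose face lattice (including $\emptyset$ and $Q$) has rank $N+1$, let $f(S)$, for $S\subseteq\{1,\dots,N\}$, be the number of chains of faces whose set of ranks is exactly $S$, let $h(S)=\sum_{T\subseteq S}(-1)^{|S\setminus T|}f(T)$, and let $\Psi(Q)=\sum_{S}h(S)\,u_S$, where $u_S=u_1\cdots u_N$ is the noncommutative monomial with $u_i=\mathbf b$ if $i\in S$ and $u_i=\mathbf a$ if $i\notin S$. With $\mathbf c=\mathbf a+\mathbf b$ and $\mathbf d=\mathbf a\mathbf b+\mathbf b\mathbf a$, the polynomial $\Psi(Q)$ is the $\mathbf{cd}$-index of $Q$. Let $M$ be a loopless matroid of rank $2$ on $[n]$ with (distinct) parallelism classes $P_1,\dots,P_k$, $k\ge 4$, and let $S=P_1\cup\dots\cup P_m$ with $2\le m\le k-2$, and $S^c=[n]\setminus S$. Then the hyperplane $H=\{x:\sum_{e\in S}x_e=1\}$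 gives a hyperplane split $Q(M)=Q(M_1)\cup Q(M_2)$, where $M_1$ is the loopless rank-$2$ matroid on $[n]$ with parallelism classes $S,P_{m+1},\dots,P_k$ and $M_2$ is the loopless rank-$2$ matroid on $[n]$ with parallelism classes $P_1,\dots,P_m,S^c$. That is, $Q(M_1)$ and $Q(M_2)$ are the parts of $Q(M)$ in the two closed half-spaces $\sum_{e\in S}x_e\le 1$ and $\sum_{e\in S}x_e\ge 1$, and $Q(M_1)\cap Q(M_2)=Q(M)\cap H$ is a proper face of both. Moreover, $$\Psi(Q(M))=\Psi(Q(M_1))+\Psi(Q(M_2))-\Psi(\Delta_{|S|}\times\Delta_{n-|S|})\cdot\mathbf c-\sum_{T}\Psi(\Delta_{|T\cap S|}\times\Delta_{|T\setminus S|})\cdot\mathbf d\cdot\Psi(\Delta_{n-|T|}),$$ where the sum is over all proper subsets $T$ of $[n]$ such that the restriction $M|_T$ has at least four parallelism classes and $S$ and $S^c$ each contain at least two parallelism classes of $M|_T$. -/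

import Mathlib

noncomputable section

namespace CDIndex

/-! ### The flag vectors and the `ab`-index of a graded poset -/

/-- Noncommutative polynomials `ℤ⟨a, b⟩`. -/
abbrev ABPoly : Type := FreeAlgebra ℤ Bool

/-- The variable `a`. -/
def a : ABPoly := FreeAlgebra.ι ℤ false

/-- The variable `b`. -/
def b : ABPoly := FreeAlgebra.ι ℤ true

/-- `c = a + b`. -/
def c : ABPoly := a + b

/-- `d = ab + ba`. -/
def d : ABPoly := a * b + b * a

section Poset

variable (P : Type*) [PartialOrder P]

/-- The rank `ρ(x)` of an element of a finite graded poset: the length of a longest chain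
below `x`. -/
def rank {P : Type*} [PartialOrder P] (x : P) : ℕ := (Order.height x).toNat

/-- The flag `f`-vector: the number of chains whose set of ranks is exactly `S`. -/
def flagF (S : Finset ℕ) : ℕ :=
  Set.ncard {C : Finset P | IsChain (· ≤ ·) (C : Set P) ∧ rank '' (C : Set P) = (S : Set ℕ)}

/-- The flag `h`-vector. -/
def flagH (S : Finset ℕ) : ℤ :=
  ∑ T ∈ S.powerset, (-1) ^ (S \ T).card * (flagF P T : ℤ)

/-- The monomial `u_S = u_1 ⋯ u_n`, with `u_i = b` if `i ∈ S` and `u_i = a` otherwise. -/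
def abMonomial (n : ℕ) (S : Finset ℕ) : ABPoly :=
  ((List.range n).map fun i => if i + 1 ∈ S then b else a).prod

/-- The `ab`-index of a graded poset of rank `n + 1` (the rank of its greatest element):
the sum of `h_P(S) u_S` over all `S ⊆ {1, …, n}`. -/
def abIndex [OrderTop P] : ABPoly :=
  ∑ S ∈ (Finset.Icc 1 (rank (⊤ : P) - 1)).powerset,
    flagH P S • abMonomial (rank (⊤ : P) - 1) S

end Poset

/-! ### Faces of polytopes -/

section Faces

variable {E : Type*} [AddCommGroup E] [Module ℝ E] [TopologicalSpace E]

/-- The poset of faces of a polytope `Q`, ordered by inclusion. The empty face and `Q` itself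
are included. -/
abbrev FacePoset (Q : Set E) : Type _ := {F : Set E // IsExposed ℝ Q F}

instance (Q : Set E) : OrderTop (FacePoset Q) where
  top := ⟨Q, IsExposed.refl Q⟩
  le_top F := F.2.subset

/-- `Ψ(Q)`, the index of the face poset of a polytope `Q`. It is the `cd`-index of `Q`, as an
element of `ℤ⟨a, b⟩` in which `c` and `d` stand for `a + b` and `ab + ba`. -/
def Psi (Q : Set E) : ABPoly := abIndex (FacePoset Q)

/-- `F` is a proper face of `Q`. -/
def IsProperFace (Q F : Set E) : Prop := IsExposed ℝ Q F ∧ F ≠ Q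

end Faces

/-- `Δ_n`, the simplex with `n` vertices, of dimension `n - 1`. -/
abbrev simplex (n : ℕ) : Set (Fin n → ℝ) := stdSimplex ℝ (Fin n)

/-! ### Matroids -/

section Matroids

variable {α : Type*}

/-- Two nonloops are parallel if they are equal or form a circuit. -/
def Parallel (M : Matroid α) (e f : α) : Prop :=
  M.IsNonloop e ∧ M.IsNonloop f ∧ (e = f ∨ M.IsCircuit {e, f})

/-- The set of parallelism classes of a matroid. -/
def parallelClasses (M : Matroid α) : Set (Set α) :=
  {C | ∃ e, M.IsNonloop e ∧ C = {f | Parallel M e f}}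

variable {n : ℕ}

/-- The matroid base polytope `Q(M)`: the convex hull of the incidence vectors of the bases. -/
def basePolytope (M : Matroid (Fin n)) : Set (Fin n → ℝ) :=
  convexHull ℝ {x | ∃ B : Set (Fin n), M.IsBase B ∧ x = B.indicator 1}

/-- The hyperplane `∑_{e ∈ S} x_e = t` gives the hyperplane split `Q(M) = Q(M₁) ∪ Q(M₂)`, where
`Q(M₁)` lies on the side `∑_{e ∈ S} x_e ≤ t` and `Q(M₂)` on the other side. -/
structure IsHyperplaneSplit (M M₁ M₂ : Matroid (Fin n)) (S : Finset (Fin n)) (t : ℝ) :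
    Prop where
  ground_left : M₁.E = Set.univ
  ground_right : M₂.E = Set.univ
  union_eq : basePolytope M = basePolytope M₁ ∪ basePolytope M₂
  face_left : IsProperFace (basePolytope M₁) (basePolytope M₁ ∩ basePolytope M₂)
  face_right : IsProperFace (basePolytope M₂) (basePolytope M₁ ∩ basePolytope M₂)
  left_eq : basePolytope M₁ = basePolytope M ∩ {x | ∑ e ∈ S, x e ≤ t}
  right_eq : basePolytope M₂ = basePolytope M ∩ {x | t ≤ ∑ e ∈ S, x e}
  inter_eq : basePolytope M₁ ∩ basePolytope M₂ = basePolytope M ∩ {x | ∑ e ∈ S, x e = t}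

open Classical in
/-- The proper subsets `T` of `[n]` such that `M|_T` has at least four parallelism classes, at
least two of which are contained in `S` and at least two of which are contained in `Sᶜ`. -/
def splitSubsets (M : Matroid (Fin n)) (S : Finset (Fin n)) : Finset (Finset (Fin n)) :=
  Finset.univ.filter fun T =>
    T ≠ Finset.univ ∧
    4 ≤ (parallelClasses (M.restrict (T : Set (Fin n)))).ncard ∧
    2 ≤ {C ∈ parallelClasses (M.restrict (T : Set (Fin n))) | C ⊆ (S : Set (Fin n))}.ncard ∧
    2 ≤ {C ∈ parallelClasses (M.restrict (T : Set (Fin n))) | C ⊆ (S : Set (Fin n))ᶜ}.ncard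

end Matroids

end CDIndex

end

/-! Replacing `a` by `a - b` turns the `ab`-index into a sum over chains of proper nonempty faces: a
chain contributes `b` at each rank that it occupies and `a - b` at every other rank
(`IsRanked.abIndex_eq`). Sorting chains by their greatest element gives the recursion Ψ(F) =
(a-b)^(r-1) + ∑ Ψ(G) b (a-b)^(r-1-ρ(G)), where r = ρ(F) and G runs over the proper nonempty faces of
F (`chainSum_eq`).

The polytope Q(M) is the convex hull of the points e_x + e_y, where xy runs over the edges of the
complete multipartite graph whose parts are the parallelism classes. Maximizing linear functionals
shows that its nonempty faces are the complete bipartite subgraphs with one part inside a class, and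
the complete multipartite subgraphs induced on vertex sets that meet at least three classes
(`mem_edgeFaces_of_maximizers`, `exists_weight_of_mem_edgeFaces`). The rank of a face is its number
of vertices, less one if the graph is bipartite.

An edge inside S lies strictly on one side of H, an edge inside Sᶜ strictly on the other, and an
edge between S and Sᶜ lies on H. The faces cut by H are therefore those given by a set T that meets
two classes inside S and two outside. The section of such a face by H is the complete bipartite
graph between T ∩ S and T \ S, a product of two simplices. The faces of Q(M₁) and Q(M₂) are the
uncut faces on their side together with, for each such T, a half of the face and its section
(`Merges.mem_edgeFaces_iff`).

The formula is proved for every cut face, by induction on T (`edgeChainSum_hyperplane_split`). Let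
Z(T) be the index of the section, and let D(T) be the sum of the indices of the two halves minus the
index of the whole face. In D(T) the uncut faces cancel except for those in H, and the recursion for
Z(T), multiplied by a - b, absorbs these. What is left is D(T) = Z(T) c + ∑ (D(U) b + Z(U) b (a-b))
(a-b)^(|T|-1-|U|), over the cut faces U ⊂ T. The inductive hypothesis and cb + b(a-b) = d produce
the terms Z(U) d, and the coefficients that follow them satisfy the recursion for the Boolean
interval from U to T, which is the face lattice of a simplex. -/

noncomputable section

namespace CDIndex

/-! ### The `ab`-index as a weighted sum over chains -/

/-- The weight `w_1 ⋯ w_n`, with `w_i = b` if `i ∈ T` and `w_i = a - b` otherwise. -/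
def chainWeight (n : ℕ) (T : Finset ℕ) : ABPoly :=
  ((List.range n).map fun i => if i + 1 ∈ T then b else a - b).prod

theorem chainWeight_succ (n : ℕ) (T : Finset ℕ) :
    chainWeight (n + 1) T = chainWeight n T * (if n + 1 ∈ T then b else a - b) := by
  simp [chainWeight, List.range_succ]

theorem abMonomial_succ (n : ℕ) (T : Finset ℕ) :
    abMonomial (n + 1) T = abMonomial n T * (if n + 1 ∈ T then b else a) := by
  simp [abMonomial, List.range_succ]

theorem chainWeight_congr {n : ℕ} {T U : Finset ℕ} (h : ∀ i ≤ n, i ∈ T ↔ i ∈ U) :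
    chainWeight n T = chainWeight n U := by
  unfold chainWeight
  congr 1
  refine List.map_congr_left fun i hi => ?_
  simp only [h (i + 1) (List.mem_range.1 hi)]

theorem abMonomial_congr {n : ℕ} {T U : Finset ℕ} (h : ∀ i ≤ n, i ∈ T ↔ i ∈ U) :
    abMonomial n T = abMonomial n U := by
  unfold abMonomial
  congr 1
  refine List.map_congr_left fun i hi => ?_
  simp only [h (i + 1) (List.mem_range.1 hi)]

theorem chainWeight_empty (n : ℕ) : chainWeight n ∅ = (a - b) ^ n := by
  simp [chainWeight]

/-- Above the greatest occupied rank `r` every letter is `a - b`, so the weight splits at `r`. This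
is what makes chain sums recursive in the top element of the chain. -/
theorem chainWeight_insert {n r : ℕ} {T : Finset ℕ} (hr : 1 ≤ r) (hn : r ≤ n)
    (hT : ∀ i ∈ T, i < r) :
    chainWeight n (insert r T) = chainWeight (r - 1) T * b * (a - b) ^ (n - r) := by
  induction n, hn using Nat.le_induction with
  | base =>
    obtain ⟨s, rfl⟩ : ∃ s, r = s + 1 := ⟨r - 1, by omega⟩
    rw [chainWeight_succ]
    simp only [Finset.mem_insert, true_or, if_true, Nat.add_sub_cancel, Nat.sub_self, pow_zero,
      mul_one]
    rw [chainWeight_congr (U := T)]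
    intro i hi
    simp only [Finset.mem_insert, or_iff_right_iff_imp]
    omega
  | succ n hn ih =>
    have h : n + 1 ∉ insert r T := by
      intro h
      rcases Finset.mem_insert.1 h with h | h
      · omega
      · have := hT _ h
        omega
    rw [chainWeight_succ, ih, if_neg h, Nat.succ_sub hn, pow_succ]
    noncomm_ring

/-- Alternating sums over subsets of the coefficients of the monomials in `a`, `b` amount to the
substitution `a ↦ a - b`. -/
theorem sum_alternating_smul_abMonomial (n : ℕ) (f : Finset ℕ → ℤ) :
    ∑ S ∈ (Finset.Icc 1 n).powerset,
        (∑ T ∈ S.powerset, (-1) ^ (S \ T).card * f T) • abMonomial n S =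
      ∑ T ∈ (Finset.Icc 1 n).powerset, f T • chainWeight n T := by
  induction n generalizing f with
  | zero => simp [abMonomial, chainWeight]
  | succ n ih =>
    have hI : Finset.Icc 1 (n + 1) = insert (n + 1) (Finset.Icc 1 n) := by
      ext i
      simp only [Finset.mem_Icc, Finset.mem_insert]
      omega
    have hn : n + 1 ∉ Finset.Icc 1 n := by simp
    have hS : ∀ S ∈ (Finset.Icc 1 n).powerset, n + 1 ∉ S := fun S hS h =>
      hn (Finset.mem_powerset.1 hS h)
    rw [hI, Finset.sum_powerset_insert hn, Finset.sum_powerset_insert hn]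
    have e1 : ∀ S ∈ (Finset.Icc 1 n).powerset,
        (∑ T ∈ S.powerset, (-1) ^ (S \ T).card * f T) • abMonomial (n + 1) S =
          ((∑ T ∈ S.powerset, (-1) ^ (S \ T).card * f T) • abMonomial n S) * a := by
      intro S h
      rw [abMonomial_succ, if_neg (hS S h), smul_mul_assoc]
    -- For a set containing `n + 1`, the subsets `T` that contain `n + 1` keep their sign and those
    -- that omit it change sign. The last letter `b` thus occurs once with each sign, and the
    -- negative part joins the `a` from `e1` to give `a - b`.
    have e2 : ∀ S ∈ (Finset.Icc 1 n).powerset,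
        (∑ T ∈ (insert (n + 1) S).powerset, (-1) ^ (insert (n + 1) S \ T).card * f T) •
            abMonomial (n + 1) (insert (n + 1) S) =
          ((∑ T ∈ S.powerset, (-1) ^ (S \ T).card * f (insert (n + 1) T)) • abMonomial n S) * b
          - ((∑ T ∈ S.powerset, (-1) ^ (S \ T).card * f T) • abMonomial n S) * b := by
      intro S h
      have h' := hS S h
      have c1 : ∀ T ∈ S.powerset,
          (-1 : ℤ) ^ (insert (n + 1) S \ T).card * f T = -((-1) ^ (S \ T).card * f T) := by
        intro T hT
        have hT' : n + 1 ∉ T := fun h => h' (Finset.mem_powerset.1 hT h)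
        rw [Finset.insert_sdiff_of_notMem _ hT', Finset.card_insert_of_notMem, pow_succ]
        · ring
        · simp [h']
      have c2 : ∀ T ∈ S.powerset,
          (-1 : ℤ) ^ (insert (n + 1) S \ insert (n + 1) T).card * f (insert (n + 1) T) =
            (-1) ^ (S \ T).card * f (insert (n + 1) T) := by
        intro T hT
        rw [Finset.insert_sdiff_insert, Finset.sdiff_insert_of_notMem h']
      rw [abMonomial_succ, if_pos (Finset.mem_insert_self _ _), Finset.sum_powerset_insert h',
        Finset.sum_congr rfl c1, Finset.sum_congr rfl c2, Finset.sum_neg_distrib,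
        abMonomial_congr (U := S), add_smul, neg_smul, smul_mul_assoc, smul_mul_assoc]
      · abel
      · intro i hi
        simp only [Finset.mem_insert, or_iff_right_iff_imp]
        omega
    have e3 : ∀ T ∈ (Finset.Icc 1 n).powerset,
        f T • chainWeight (n + 1) T = (f T • chainWeight n T) * (a - b) := by
      intro S h
      rw [chainWeight_succ, if_neg (hS S h), smul_mul_assoc]
    have e4 : ∀ T ∈ (Finset.Icc 1 n).powerset,
        f (insert (n + 1) T) • chainWeight (n + 1) (insert (n + 1) T) =
          (f (insert (n + 1) T) • chainWeight n T) * b := by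
      intro S h
      rw [chainWeight_succ, if_pos (Finset.mem_insert_self _ _), smul_mul_assoc,
        chainWeight_congr (U := S)]
      intro i hi
      simp only [Finset.mem_insert, or_iff_right_iff_imp]
      omega
    rw [Finset.sum_congr rfl e1, Finset.sum_congr rfl e2, Finset.sum_congr rfl e3,
      Finset.sum_congr rfl e4, Finset.sum_sub_distrib, ← Finset.sum_mul, ← Finset.sum_mul,
      ← Finset.sum_mul, ← Finset.sum_mul, ← Finset.sum_mul, ih, ih fun T => f (insert (n + 1) T)]
    noncomm_ring

section Chains

variable {α : Type*} [PartialOrder α]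

open Classical in
/-- The elements of `L` below `x`. -/
def below (L : Finset α) (x : α) : Finset α := L.filter (· < x)

open Classical in
/-- The chains of elements of `L` below `x`. -/
def chainsBelow (L : Finset α) (x : α) : Finset (Finset α) :=
  (below L x).powerset.filter fun C => IsChain (· ≤ ·) (C : Set α)

/-- The sum of the weights of the chains of elements of `L` below `x`. -/
def chainSum (L : Finset α) (ρ : α → ℕ) (x : α) : ABPoly :=
  ∑ C ∈ chainsBelow L x, chainWeight (ρ x - 1) (C.image ρ)

@[simp]
theorem mem_below {L : Finset α} {x y : α} : y ∈ below L x ↔ y ∈ L ∧ y < x := by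
  simp [below]

theorem mem_chainsBelow {L : Finset α} {x : α} {C : Finset α} :
    C ∈ chainsBelow L x ↔ (∀ y ∈ C, y ∈ L ∧ y < x) ∧ IsChain (· ≤ ·) (C : Set α) := by
  simp [chainsBelow, Finset.subset_iff]

theorem chainSum_congr {L L' : Finset α} (ρ : α → ℕ) {x : α} (h : below L x = below L' x) :
    chainSum L ρ x = chainSum L' ρ x := by
  simp only [chainSum, chainsBelow, h]

/-- The sum over chains, organised by the greatest element of the chain. -/
theorem chainSum_eq (L : Finset α) (ρ : α → ℕ) (x : α) (hpos : ∀ y ∈ L, 1 ≤ ρ y)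
    (hmono : ∀ y ∈ L, ∀ z ∈ L, y < z → ρ y < ρ z) (hx : ∀ y ∈ L, y < x → ρ y < ρ x) :
    chainSum L ρ x = (a - b) ^ (ρ x - 1) +
      ∑ y ∈ below L x, chainSum L ρ y * b * (a - b) ^ (ρ x - 1 - ρ y) := by
  classical
  -- A nonempty finite chain has a greatest element `y`, and what remains is a chain below `y`.
  have hC : chainsBelow L x =
      insert ∅ ((below L x).biUnion fun y => (chainsBelow L y).image (insert y)) := by
    ext C
    simp only [Finset.mem_insert, Finset.mem_biUnion, Finset.mem_image, mem_below]
    constructor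
    · intro h
      rw [mem_chainsBelow] at h
      rcases C.eq_empty_or_nonempty with h0 | h0
      · exact Or.inl h0
      right
      obtain ⟨y, hy⟩ := C.exists_maximal h0
      have hlt : ∀ z ∈ C, z ≠ y → z < y := fun z hz hzy => by
        rcases h.2 hz hy.1 hzy with h1 | h1
        · exact lt_of_le_of_ne h1 hzy
        · exact absurd (le_antisymm (hy.2 hz h1) h1) hzy
      refine ⟨y, h.1 y hy.1, C.erase y, ?_, Finset.insert_erase hy.1⟩
      rw [mem_chainsBelow]
      refine ⟨fun z hz => ?_, h.2.mono (by simp)⟩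
      rw [Finset.mem_erase] at hz
      exact ⟨(h.1 z hz.2).1, hlt z hz.2 hz.1⟩
    · rintro (rfl | ⟨y, hy, D, hD, rfl⟩)
      · simp [mem_chainsBelow]
      · rw [mem_chainsBelow] at hD ⊢
        refine ⟨fun z hz => ?_, ?_⟩
        · rcases Finset.mem_insert.1 hz with rfl | hz
          · exact hy
          · exact ⟨(hD.1 z hz).1, (hD.1 z hz).2.trans hy.2⟩
        · rw [Finset.coe_insert]
          exact hD.2.insert fun z hz _ => Or.inr (hD.1 z hz).2.le
  have hnot : ∀ y, ∀ D ∈ chainsBelow L y, y ∉ D := fun y D hD hy =>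
    lt_irrefl y ((mem_chainsBelow.1 hD).1 y hy).2
  rw [chainSum, hC, Finset.sum_insert, Finset.image_empty, chainWeight_empty, Finset.sum_biUnion]
  · congr 1
    refine Finset.sum_congr rfl fun y hy => ?_
    rw [mem_below] at hy
    rw [Finset.sum_image, chainSum, Finset.sum_mul, Finset.sum_mul]
    · refine Finset.sum_congr rfl fun D hD => ?_
      have := hx y hy.1 hy.2
      rw [Finset.image_insert, chainWeight_insert (hpos y hy.1) (by omega)]
      intro i hi
      obtain ⟨z, hz, rfl⟩ := Finset.mem_image.1 hi
      have := (mem_chainsBelow.1 hD).1 z hz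
      exact hmono z this.1 y hy.1 this.2
    · intro D hD D' hD' h
      rw [← Finset.erase_insert (hnot y D hD), ← Finset.erase_insert (hnot y D' hD')]
      exact congrArg (fun C => Finset.erase C y) h
  -- If the same chain arose from two greatest elements, each would lie strictly below the other.
  · intro y hy z hz hyz
    rw [Function.onFun, Finset.disjoint_left]
    intro C hCy hCz
    obtain ⟨D, hD, rfl⟩ := Finset.mem_image.1 hCy
    obtain ⟨D', hD', h⟩ := Finset.mem_image.1 hCz
    have h1 : z < y := by
      have : z ∈ insert y D := h ▸ Finset.mem_insert_self z D'
      exact ((mem_chainsBelow.1 hD).1 z ((Finset.mem_insert.1 this).resolve_left hyz.symm)).2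
    have h2 : y < z := by
      have : y ∈ insert z D' := h ▸ Finset.mem_insert_self y D
      exact ((mem_chainsBelow.1 hD').1 y ((Finset.mem_insert.1 this).resolve_left hyz)).2
    exact lt_asymm h1 h2
  · simp only [Finset.mem_biUnion, Finset.mem_image, not_exists, not_and]
    intro y _ D _
    exact Finset.insert_ne_empty y D

/-! ### Ranked posets embedded in a larger order -/

variable {P : Type*} [PartialOrder P]

/-- The conditions under which `ρ` is the rank function of the image of `P` in `α`. -/
structure IsRanked (φ : P ↪o α) (L : Finset α) (x₀ : α) (ρ : α → ℕ) : Prop where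
  notMem : x₀ ∉ L
  range_eq : Set.range φ = insert x₀ (L : Set α)
  rank_bot : ρ x₀ = 0
  strictMono : ∀ x, (x = x₀ ∨ x ∈ L) → ∀ y, (y = x₀ ∨ y ∈ L) → x < y → ρ x < ρ y
  exists_pred : ∀ x ∈ L, ∃ y, (y = x₀ ∨ y ∈ L) ∧ y < x ∧ ρ y + 1 = ρ x

namespace IsRanked

variable {φ : P ↪o α} {L : Finset α} {x₀ : α} {ρ : α → ℕ}

theorem mem (h : IsRanked φ L x₀ ρ) (p : P) : φ p = x₀ ∨ φ p ∈ L := by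
  have : φ p ∈ Set.range φ := ⟨p, rfl⟩
  rw [h.range_eq] at this
  simpa using this

theorem pos (h : IsRanked φ L x₀ ρ) {x : α} (hx : x ∈ L) : 1 ≤ ρ x := by
  obtain ⟨y, -, -, hy⟩ := h.exists_pred x hx
  omega

/-- Strict monotonicity of `ρ` bounds the height above by `ρ`, and descending through elements of
rank one less bounds it below. -/
theorem rank_eq (h : IsRanked φ L x₀ ρ) (p : P) : rank p = ρ (φ p) := by
  have hs : StrictMono fun q => ρ (φ q) := fun q r hqr =>
    h.strictMono _ (h.mem q) _ (h.mem r) (φ.lt_iff_lt.2 hqr)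
  have key : ∀ n : ℕ, ∀ q : P, ρ (φ q) = n → Order.height q = n := by
    intro n
    induction n with
    | zero =>
      intro q hq
      rw [Nat.cast_zero, Order.height_eq_zero]
      intro r hr
      by_contra hqr
      have := hs (lt_of_le_not_ge hr hqr)
      simp only at this
      omega
    | succ n ih =>
      intro q hq
      apply le_antisymm
      · have := Order.height_le_height_apply_of_strictMono _ hs q
        rwa [Order.height_nat, hq] at this
      · have hqL : φ q ∈ L := by
          rcases h.mem q with h0 | h0
          · rw [h0, h.rank_bot] at hq
            omega
          · exact h0
        obtain ⟨y, hy, hlt, hr⟩ := h.exists_pred _ hqL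
        obtain ⟨r, rfl⟩ : y ∈ Set.range φ := by
          rw [h.range_eq]
          simpa using hy
        have h1 := ih r (by omega)
        have h2 := Order.height_add_one_le (φ.lt_iff_lt.1 hlt)
        rw [h1] at h2
        exact_mod_cast h2
  rw [rank, key _ p rfl, ENat.toNat_natCast]

/-- Since `S` contains neither 0 nor the rank of the top, a chain with rank set `S` uses neither the
bottom element `x₀` nor the top, and so lies in `L` strictly below `φ ⊤`. -/
theorem flagF_eq [OrderTop P] [DecidableEq α] (h : IsRanked φ L x₀ ρ) {S : Finset ℕ}
    (hS : S ⊆ Finset.Icc 1 (ρ (φ ⊤) - 1)) :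
    flagF P S = ((chainsBelow L (φ ⊤)).filter fun C => C.image ρ = S).card := by
  classical
  rw [flagF, ← Set.ncard_coe_finset]
  refine Set.ncard_congr (fun C _ => C.map φ.toEmbedding) ?_ ?_ ?_
  · rintro C ⟨hC, hr⟩
    rw [Finset.mem_coe, Finset.mem_filter, mem_chainsBelow]
    have hr' : ∀ p ∈ C, ρ (φ p) ∈ S := fun p hp => by
      have : rank p ∈ (S : Set ℕ) := hr ▸ ⟨p, hp, rfl⟩
      rwa [h.rank_eq] at this
    refine ⟨⟨?_, ?_⟩, ?_⟩
    · intro y hy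
      obtain ⟨p, hp, rfl⟩ := Finset.mem_map.1 hy
      have h1 := Finset.mem_Icc.1 (hS (hr' p hp))
      refine ⟨(h.mem p).resolve_left fun h0 => ?_, ?_⟩
      · rw [h0, h.rank_bot] at h1
        omega
      · refine φ.lt_iff_lt.2 (lt_of_le_of_ne le_top ?_)
        rintro rfl
        omega
    · rw [Finset.coe_map]
      rintro _ ⟨p, hp, rfl⟩ _ ⟨q, hq, rfl⟩ hne
      rcases hC hp hq (fun h => hne (by rw [h])) with h1 | h1
      · exact Or.inl (φ.le_iff_le.2 h1)
      · exact Or.inr (φ.le_iff_le.2 h1)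
    · ext i
      have := Set.ext_iff.1 hr i
      simp only [Set.mem_image, Finset.mem_coe, h.rank_eq] at this
      simpa using this
  · intro C D _ _ hCD
    exact Finset.map_injective _ hCD
  · intro C hC
    rw [Finset.mem_coe, Finset.mem_filter, mem_chainsBelow] at hC
    obtain ⟨D, hD⟩ : ∃ D : Finset P, D.map φ.toEmbedding = C := by
      refine ⟨C.preimage φ φ.injective.injOn, ?_⟩
      ext y
      simp only [Finset.mem_map, Finset.mem_preimage, RelEmbedding.coe_toEmbedding]
      constructor
      · rintro ⟨p, hp, rfl⟩
        exact hp
      · intro hy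
        obtain ⟨p, rfl⟩ : y ∈ Set.range φ := by
          rw [h.range_eq]
          exact Or.inr (hC.1.1 y hy).1
        exact ⟨p, hy, rfl⟩
    subst hD
    refine ⟨D, ⟨?_, ?_⟩, rfl⟩
    · intro p hp q hq hne
      rcases hC.1.2 (Finset.mem_coe.2 (Finset.mem_map_of_mem _ hp))
        (Finset.mem_coe.2 (Finset.mem_map_of_mem _ hq)) (fun h => hne (φ.injective h)) with h1 | h1
      · exact Or.inl (φ.le_iff_le.1 h1)
      · exact Or.inr (φ.le_iff_le.1 h1)
    · rw [← hC.2]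
      ext i
      simp [h.rank_eq]

/-- The `ab`-index of a ranked poset is the sum of the weights of its chains. -/
theorem abIndex_eq [OrderTop P] (h : IsRanked φ L x₀ ρ) :
    abIndex P = chainSum L ρ (φ ⊤) := by
  classical
  rw [abIndex, h.rank_eq]
  simp only [flagH]
  rw [sum_alternating_smul_abMonomial _ fun T => (flagF P T : ℤ), chainSum,
    ← Finset.sum_fiberwise_of_maps_to (g := fun C : Finset α => C.image ρ)
      (t := (Finset.Icc 1 (ρ (φ ⊤) - 1)).powerset)]
  · refine Finset.sum_congr rfl fun T hT => ?_
    rw [h.flagF_eq (Finset.mem_powerset.1 hT), Finset.sum_congr rfl (g := fun _ =>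
      chainWeight (ρ (φ ⊤) - 1) T), Finset.sum_const]
    · simp
    · intro C hC
      rw [(Finset.mem_filter.1 hC).2]
  · intro C hC
    rw [mem_chainsBelow] at hC
    rw [Finset.mem_powerset]
    intro i hi
    obtain ⟨y, hy, rfl⟩ := Finset.mem_image.1 hi
    have h1 := hC.1 y hy
    have h2 := h.pos h1.1
    have h3 := h.strictMono y (Or.inr h1.1) _ (h.mem ⊤) h1.2
    rw [Finset.mem_Icc]
    omega

end IsRanked

end Chains

end CDIndex

namespace CDIndex

/-! ### Faces of a polytope as sets of vertices -/

section VertexSets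

variable {E : Type*} [AddCommGroup E] [Module ℝ E] [TopologicalSpace E]
  {ι : Type*} [Fintype ι] (v : ι → E)

open Classical in
/-- The set of (indices of) vertices in `F`. -/
def vertexSet (F : Set E) : Finset ι := Finset.univ.filter fun i => v i ∈ F

omit [AddCommGroup E] [Module ℝ E] [TopologicalSpace E] in
@[simp]
theorem mem_vertexSet {F : Set E} {i : ι} : i ∈ vertexSet v F ↔ v i ∈ F := by
  simp [vertexSet]

omit [TopologicalSpace E] [Fintype ι] in
/-- A point of a polytope at which a functional takes its maximum is in the convex hull of the
vertices at which it does. -/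
theorem mem_convexHull_maximizers (l : E →ₗ[ℝ] ℝ) {x : E} (hx : x ∈ convexHull ℝ (Set.range v))
    (hmax : ∀ i, l (v i) ≤ l x) : x ∈ convexHull ℝ (v '' {i | l (v i) = l x}) := by
  set K := convexHull ℝ (v '' {i | l (v i) = l x}) with hK
  have hKl : ∀ y ∈ K, l y = l x := by
    intro y hy
    have : K ⊆ {z | l z = l x} := by
      refine convexHull_min ?_ (convex_hyperplane l.isLinear _)
      rintro _ ⟨i, hi, rfl⟩
      exact hi
    exact this hy
  -- The open half-space together with `K` is convex: a proper convex combination stays in `K` if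
  -- both points do, and otherwise falls strictly below the maximum. It contains every vertex, hence
  -- the polytope, and `x` is not in the open half-space.
  have hW : Convex ℝ ({y | l y < l x} ∪ K) := by
    intro y hy z hz s t hs ht hst
    have hle : ∀ u ∈ {y | l y < l x} ∪ K, l u ≤ l x := by
      rintro u (hu | hu)
      · exact le_of_lt hu
      · exact (hKl u hu).le
    rcases hs.eq_or_lt with rfl | hs
    · obtain rfl : t = 1 := by linarith
      simpa using hz
    rcases ht.eq_or_lt with rfl | ht
    · obtain rfl : s = 1 := by linarith
      simpa using hy
    by_cases hyz : y ∈ K ∧ z ∈ K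
    · exact Or.inr (convex_convexHull ℝ _ hyz.1 hyz.2 hs.le ht.le hst)
    · left
      have h1 := hle y hy
      have h2 := hle z hz
      have h3 : l y < l x ∨ l z < l x := by
        rcases hy with hy | hy
        · exact Or.inl hy
        · rcases hz with hz | hz
          · exact Or.inr hz
          · exact absurd ⟨hy, hz⟩ hyz
      have h4 : l x = s * l x + t * l x := by rw [← add_mul, hst, one_mul]
      simp only [Set.mem_ofPred, map_add, map_smul, smul_eq_mul]
      rcases h3 with h3 | h3
      · nlinarith [mul_lt_mul_of_pos_left h3 hs, mul_le_mul_of_nonneg_left h2 ht.le]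
      · nlinarith [mul_lt_mul_of_pos_left h3 ht, mul_le_mul_of_nonneg_left h1 hs.le]
  have hsub : convexHull ℝ (Set.range v) ⊆ {y | l y < l x} ∪ K := by
    refine convexHull_min ?_ hW
    rintro _ ⟨i, rfl⟩
    rcases (hmax i).lt_or_eq with h | h
    · exact Or.inl h
    · exact Or.inr (subset_convexHull ℝ _ ⟨i, h, rfl⟩)
  exact (hsub hx).resolve_left fun h => lt_irrefl (l x) h

variable {v} {Q : Set E} (hQ : Q = convexHull ℝ (Set.range v))

include hQ

omit [TopologicalSpace E] [Fintype ι] in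
theorem le_on_polytope_iff (l : E →ₗ[ℝ] ℝ) (r : ℝ) :
    (∀ y ∈ Q, l y ≤ r) ↔ ∀ i, l (v i) ≤ r := by
  subst hQ
  constructor
  · exact fun h i => h _ (subset_convexHull ℝ _ ⟨i, rfl⟩)
  · intro h y hy
    have : convexHull ℝ (Set.range v) ⊆ {z | l z ≤ r} := by
      refine convexHull_min ?_ (convex_halfSpace_le l.isLinear _)
      rintro _ ⟨i, rfl⟩
      exact h i
    exact this hy

/-- The functional that exposes `F` attains its maximum at each point of `F`, so the point is a
combination of maximizing vertices, which belong to `F`. A face is therefore determined by its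
vertices. -/
theorem exposed_subset_convexHull_vertexSet {F : Set E} (hF : IsExposed ℝ Q F) :
    F ⊆ convexHull ℝ (v '' (vertexSet v F : Set ι)) := by
  intro x hx
  obtain ⟨l, hl⟩ := hF ⟨x, hx⟩
  have hx' := hx
  rw [hl] at hx'
  have h1 := mem_convexHull_maximizers v (l : E →ₗ[ℝ] ℝ) (hQ ▸ hx'.1)
    ((le_on_polytope_iff hQ (l : E →ₗ[ℝ] ℝ) _).1 hx'.2)
  refine convexHull_mono (Set.image_mono ?_) h1
  intro i hi
  rw [Finset.mem_coe, mem_vertexSet, hl]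
  refine ⟨hQ ▸ subset_convexHull ℝ _ ⟨i, rfl⟩, fun y hy => ?_⟩
  have : l (v i) = l x := hi
  rw [this]
  exact hx'.2 y hy

omit [Fintype ι] in
theorem exposed_convex {F : Set E} (hF : IsExposed ℝ Q F) : Convex ℝ F := by
  rcases F.eq_empty_or_nonempty with rfl | h
  · exact convex_empty
  obtain ⟨l, a, rfl⟩ := hF.eq_inter_halfSpace' h
  exact Convex.inter (hQ ▸ convex_convexHull ℝ _) (convex_halfSpace_ge l.isLinear a)

/-- The face poset of a polytope embeds into the poset of sets of vertices. -/
def faceEmbedding : FacePoset Q ↪o Finset ι :=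
  OrderEmbedding.ofMapLEIff (fun F => vertexSet v F.1) <| by
    intro F G
    constructor
    · intro h
      refine (exposed_subset_convexHull_vertexSet hQ F.2).trans
        (convexHull_min ?_ (exposed_convex hQ G.2))
      rintro _ ⟨i, hi, rfl⟩
      exact (mem_vertexSet v).1 (h hi)
    · intro h i hi
      exact (mem_vertexSet v).2 (h ((mem_vertexSet v).1 hi))

theorem faceEmbedding_top : faceEmbedding hQ ⊤ = Finset.univ := by
  ext i
  refine ⟨fun _ => Finset.mem_univ i, fun _ => (mem_vertexSet v).2 ?_⟩
  change v i ∈ Q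
  rw [hQ]
  exact subset_convexHull ℝ _ ⟨i, rfl⟩

/-- The nonempty faces are the sets of vertices at which a functional is maximal. -/
theorem mem_range_faceEmbedding {s : Finset ι} :
    s ∈ Set.range (faceEmbedding hQ) ↔
      s = ∅ ∨ (s.Nonempty ∧ ∃ l : StrongDual ℝ E, ∀ i, i ∈ s ↔ ∀ j, l (v j) ≤ l (v i)) := by
  constructor
  · rintro ⟨F, rfl⟩
    change vertexSet v F.1 = ∅ ∨ ((vertexSet v F.1).Nonempty ∧ _)
    rcases (vertexSet v F.1).eq_empty_or_nonempty with h | h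
    · exact Or.inl h
    · refine Or.inr ⟨h, ?_⟩
      obtain ⟨i, hi⟩ := h
      obtain ⟨l, hl⟩ := F.2 ⟨_, (mem_vertexSet v).1 hi⟩
      refine ⟨l, fun j => ?_⟩
      change j ∈ vertexSet v F.1 ↔ _
      rw [mem_vertexSet, hl]
      have := le_on_polytope_iff hQ (l : E →ₗ[ℝ] ℝ) (l (v j))
      simp only [ContinuousLinearMap.coe_coe] at this
      simp only [Set.mem_ofPred, this, and_iff_right_iff_imp]
      intro _
      rw [hQ]
      exact subset_convexHull ℝ _ ⟨j, rfl⟩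
  -- The empty set counts as exposed by convention, with no functional needed. It supplies the
  -- bottom element of the face lattice.
  · rintro (rfl | ⟨_, l, hl⟩)
    · refine ⟨⟨∅, isExposed_empty⟩, ?_⟩
      ext i
      simp [faceEmbedding]
    · refine ⟨⟨l.toExposed Q, ContinuousLinearMap.toExposed.isExposed⟩, ?_⟩
      ext j
      change j ∈ vertexSet v (l.toExposed Q) ↔ _
      have := le_on_polytope_iff hQ (l : E →ₗ[ℝ] ℝ) (l (v j))
      simp only [ContinuousLinearMap.coe_coe] at this
      rw [mem_vertexSet, hl, ContinuousLinearMap.toExposed]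
      simp only [Set.mem_ofPred, this, and_iff_right_iff_imp]
      intro _
      rw [hQ]
      exact subset_convexHull ℝ _ ⟨j, rfl⟩

end VertexSets

end CDIndex

namespace CDIndex

/-! ### The faces of base polytopes of rank-two matroids as edge sets of graphs -/

section EdgeSets

variable {V κ : Type*} [Fintype V] [DecidableEq V]

/-- The (ordered) edges of the complete bipartite graph with parts `A` and `B`. -/
def biclique (A B : Finset V) : Finset (V × V) := A ×ˢ B ∪ B ×ˢ A

open Classical in
/-- The (ordered) edges of the complete multipartite graph on `T` whose parts are the classes of
the labelling `f`. -/
def multipartite (f : V → κ) (T : Finset V) : Finset (V × V) :=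
  (T ×ˢ T).filter fun p => f p.1 ≠ f p.2

/-- The vertices covered by a symmetric set of edges. -/
def edgeSupport (F : Finset (V × V)) : Finset V := F.image Prod.fst

/-- A set of edges is bipartite. -/
def IsBip (F : Finset (V × V)) : Prop := ∃ A : Finset V, ∀ p ∈ F, p.1 ∈ A ↔ p.2 ∉ A

open Classical in
/-- The rank of a connected graph: the dimension of the span of the incidence vectors of its
edges. -/
def edgeRank (F : Finset (V × V)) : ℕ := (edgeSupport F).card - if IsBip F then 1 else 0

/-- `F` is a nonempty complete bipartite graph one of whose parts is contained in a class. -/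
def IsClassBiclique (f : V → κ) (F : Finset (V × V)) : Prop :=
  ∃ k A B, A.Nonempty ∧ B.Nonempty ∧ (∀ x ∈ A, f x = k) ∧ (∀ x ∈ B, f x ≠ k) ∧ F = biclique A B

/-- `T` meets at least three classes. -/
def MeetsThree (f : V → κ) (T : Finset V) : Prop :=
  ∃ x ∈ T, ∃ y ∈ T, ∃ z ∈ T, f x ≠ f y ∧ f x ≠ f z ∧ f y ≠ f z

open Classical in
/-- The edge sets of the nonempty faces of the base polytope of the loopless rank-two matroid
whose parallelism classes are the classes of `f`. -/
def edgeFaces (f : V → κ) : Finset (Finset (V × V)) :=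
  Finset.univ.filter fun F =>
    IsClassBiclique f F ∨ ∃ T, MeetsThree f T ∧ F = multipartite f T

variable {f : V → κ} {A B C D T U : Finset V} {F G : Finset (V × V)}

theorem mem_edgeFaces :
    F ∈ edgeFaces f ↔ IsClassBiclique f F ∨ ∃ T, MeetsThree f T ∧ F = multipartite f T := by
  simp [edgeFaces]

omit [Fintype V] in
theorem mem_biclique {p : V × V} :
    p ∈ biclique A B ↔ (p.1 ∈ A ∧ p.2 ∈ B) ∨ (p.1 ∈ B ∧ p.2 ∈ A) := by
  simp [biclique, Finset.mem_product]

omit [Fintype V] [DecidableEq V] in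
theorem mem_multipartite {p : V × V} :
    p ∈ multipartite f T ↔ p.1 ∈ T ∧ p.2 ∈ T ∧ f p.1 ≠ f p.2 := by
  simp [multipartite, Finset.mem_product, and_assoc]

omit [Fintype V] in
theorem biclique_comm : biclique A B = biclique B A := by
  ext p
  rw [mem_biclique, mem_biclique, or_comm]

omit [Fintype V] in
theorem edgeSupport_mono (h : F ⊆ G) : edgeSupport F ⊆ edgeSupport G :=
  Finset.image_subset_image h

omit [Fintype V] [DecidableEq V] in
theorem IsBip.mono (h : F ⊆ G) (hG : IsBip G) : IsBip F := by
  obtain ⟨A, hA⟩ := hG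
  exact ⟨A, fun p hp => hA p (h hp)⟩

omit [Fintype V] in
theorem edgeSupport_biclique (hA : A.Nonempty) (hB : B.Nonempty) :
    edgeSupport (biclique A B) = A ∪ B := by
  obtain ⟨x, hx⟩ := hA
  obtain ⟨y, hy⟩ := hB
  ext z
  simp only [edgeSupport, Finset.mem_image, mem_biclique, Finset.mem_union, Prod.exists,
    exists_and_right, exists_eq_right]
  constructor
  · rintro ⟨u, ⟨h, -⟩ | ⟨h, -⟩⟩
    · exact Or.inl h
    · exact Or.inr h
  · rintro (h | h)
    · exact ⟨y, Or.inl ⟨h, hy⟩⟩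
    · exact ⟨x, Or.inr ⟨h, hx⟩⟩

omit [Fintype V] in
theorem edgeSupport_multipartite {x y : V} (hx : x ∈ T) (hy : y ∈ T) (hxy : f x ≠ f y) :
    edgeSupport (multipartite f T) = T := by
  ext z
  simp only [edgeSupport, Finset.mem_image, mem_multipartite, Prod.exists,
    exists_and_right, exists_eq_right]
  constructor
  · rintro ⟨u, h, -⟩
    exact h
  · intro h
    by_cases hz : f z = f x
    · exact ⟨y, h, hy, hz ▸ hxy⟩
    · exact ⟨x, h, hx, hz⟩

omit [Fintype V] in
theorem MeetsThree.edgeSupport_eq (h : MeetsThree f T) : edgeSupport (multipartite f T) = T := by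
  obtain ⟨x, hx, y, hy, -, -, hxy, -⟩ := h
  exact edgeSupport_multipartite hx hy hxy

omit [Fintype V] in
theorem isBip_biclique (h : Disjoint A B) : IsBip (biclique A B) := by
  refine ⟨A, fun p hp => ?_⟩
  rw [Finset.disjoint_left] at h
  rcases mem_biclique.1 hp with ⟨h1, h2⟩ | ⟨h1, h2⟩
  · exact ⟨fun _ h3 => h h3 h2, fun _ => h1⟩
  · exact ⟨fun h3 => absurd h1 (h h3), fun h3 => absurd h2 h3⟩

-- Three vertices in different classes span a triangle.
omit [Fintype V] [DecidableEq V] in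
theorem MeetsThree.not_isBip (h : MeetsThree f T) : ¬ IsBip (multipartite f T) := by
  rintro ⟨A, hA⟩
  obtain ⟨x, hx, y, hy, z, hz, hxy, hxz, hyz⟩ := h
  have h1 := hA (x, y) (mem_multipartite.2 ⟨hx, hy, hxy⟩)
  have h2 := hA (x, z) (mem_multipartite.2 ⟨hx, hz, hxz⟩)
  have h3 := hA (y, z) (mem_multipartite.2 ⟨hy, hz, hyz⟩)
  simp only at h1 h2 h3
  tauto

omit [Fintype V] in
theorem edgeRank_biclique (hA : A.Nonempty) (hB : B.Nonempty) (h : Disjoint A B) :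
    edgeRank (biclique A B) = A.card + B.card - 1 := by
  rw [edgeRank, edgeSupport_biclique hA hB, if_pos (isBip_biclique h),
    Finset.card_union_of_disjoint h]

omit [Fintype V] in
theorem MeetsThree.edgeRank_eq (h : MeetsThree f T) : edgeRank (multipartite f T) = T.card := by
  rw [edgeRank, h.edgeSupport_eq, if_neg h.not_isBip, Nat.sub_zero]

omit [Fintype V] in
theorem edgeRank_empty : edgeRank (∅ : Finset (V × V)) = 0 := by
  simp [edgeRank, edgeSupport]

omit [Fintype V] [DecidableEq V] in
theorem disjoint_of_class {k : κ} (hA : ∀ x ∈ A, f x = k) (hB : ∀ x ∈ B, f x ≠ k) :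
    Disjoint A B :=
  Finset.disjoint_left.2 fun x h1 h2 => hB x h2 (hA x h1)

-- One edge fixes which part goes into which, and disjointness of `C` and `D` propagates the choice
-- to all other edges.
omit [Fintype V] in
theorem biclique_subset_cases (hA : A.Nonempty) (hB : B.Nonempty) (hCD : Disjoint C D)
    (h : biclique A B ⊆ biclique C D) : (A ⊆ C ∧ B ⊆ D) ∨ (A ⊆ D ∧ B ⊆ C) := by
  obtain ⟨x, hx⟩ := hA
  obtain ⟨y, hy⟩ := hB
  rw [Finset.disjoint_left] at hCD
  have key : ∀ u ∈ A, ∀ w ∈ B, (u ∈ C ∧ w ∈ D) ∨ (u ∈ D ∧ w ∈ C) := fun u hu w hw =>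
    mem_biclique.1 (h ((mem_biclique (p := (u, w))).2 (Or.inl ⟨hu, hw⟩)))
  rcases key x hx y hy with ⟨h1, h2⟩ | ⟨h1, h2⟩
  · left
    refine ⟨fun u hu => ?_, fun w hw => ?_⟩
    · exact (key u hu y hy).elim And.left fun h3 => absurd h2 (hCD h3.2)
    · exact (key x hx w hw).elim And.right fun h3 => absurd h3.1 (hCD h1)
  · right
    refine ⟨fun u hu => ?_, fun w hw => ?_⟩
    · exact (key u hu y hy).elim (fun h3 => absurd h3.2 (hCD h2)) And.left
    · exact (key x hx w hw).elim (fun h3 => absurd h1 (hCD h3.1)) And.right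

-- The bipartition of a connected bipartite graph is unique, so a complete bipartite subgraph on all
-- the vertices is the whole graph. Strict inclusions of bicliques hence enlarge the vertex set.
omit [Fintype V] in
theorem biclique_eq_of_subset (hA : A.Nonempty) (hB : B.Nonempty) (hCD : Disjoint C D)
    (h : biclique A B ⊆ biclique C D) (hU : A ∪ B = C ∪ D) :
    biclique A B = biclique C D := by
  have aux : ∀ {A B : Finset V}, A ⊆ C → B ⊆ D → A ∪ B = C ∪ D → A = C ∧ B = D := by
    intro A B h1 h2 hU
    rw [Finset.disjoint_left] at hCD
    refine ⟨h1.antisymm fun x hx => ?_, h2.antisymm fun x hx => ?_⟩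
    · have : x ∈ A ∪ B := hU ▸ Finset.mem_union_left D hx
      exact (Finset.mem_union.1 this).resolve_right fun h3 => hCD hx (h2 h3)
    · have : x ∈ A ∪ B := hU ▸ Finset.mem_union_right C hx
      exact (Finset.mem_union.1 this).resolve_left fun h3 => hCD (h1 h3) hx
  rcases biclique_subset_cases hA hB hCD h with ⟨h1, h2⟩ | ⟨h1, h2⟩
  · obtain ⟨rfl, rfl⟩ := aux h1 h2 hU
    rfl
  · obtain ⟨rfl, rfl⟩ := aux h2 h1 (by rw [Finset.union_comm, hU])
    exact biclique_comm

omit [Fintype V] in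
/-- A complete multipartite graph with at least two parts is of one of the two kinds. -/
theorem multipartite_cases {x y : V} (hx : x ∈ T) (hy : y ∈ T) (hxy : f x ≠ f y) :
    IsClassBiclique f (multipartite f T) ∨ MeetsThree f T := by
  classical
  by_cases h : ∃ z ∈ T, f z ≠ f x ∧ f z ≠ f y
  · obtain ⟨z, hz, h1, h2⟩ := h
    exact Or.inr ⟨x, hx, y, hy, z, hz, hxy, h1.symm, h2.symm⟩
  · push Not at h
    refine Or.inl ⟨f x, T.filter (f · = f x), T.filter (f · ≠ f x), ⟨x, by simp [hx]⟩,
      ⟨y, by simp [hy, hxy.symm]⟩, by simp, by simp, ?_⟩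
    ext ⟨u, w⟩
    simp only [mem_multipartite, mem_biclique, Finset.mem_filter]
    constructor
    · rintro ⟨hu, hw, huw⟩
      by_cases hux : f u = f x
      · exact Or.inl ⟨⟨hu, hux⟩, hw, fun h => huw (hux.trans h.symm)⟩
      · refine Or.inr ⟨⟨hu, hux⟩, hw, ?_⟩
        by_contra hwx
        exact huw ((h u hu hux).trans (h w hw hwx).symm)
    · rintro (⟨⟨hu, hux⟩, hw, hwx⟩ | ⟨⟨hu, hux⟩, hw, hwx⟩)
      · exact ⟨hu, hw, fun h => hwx (h ▸ hux)⟩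
      · exact ⟨hu, hw, fun h => hux (h.trans hwx)⟩

theorem multipartite_mem_edgeFaces {x y : V} (hx : x ∈ T) (hy : y ∈ T) (hxy : f x ≠ f y) :
    multipartite f T ∈ edgeFaces f :=
  mem_edgeFaces.2 ((multipartite_cases hx hy hxy).imp_right fun h => ⟨T, h, rfl⟩)

theorem edgeRank_pos (hF : F ∈ edgeFaces f) : 1 ≤ edgeRank F := by
  rcases mem_edgeFaces.1 hF with ⟨k, A, B, hA, hB, hAk, hBk, rfl⟩ | ⟨T, hT, rfl⟩
  · rw [edgeRank_biclique hA hB (disjoint_of_class hAk hBk)]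
    have := hA.card_pos
    have := hB.card_pos
    omega
  · rw [hT.edgeRank_eq]
    obtain ⟨x, hx, -⟩ := hT
    exact Finset.card_pos.2 ⟨x, hx⟩

theorem empty_notMem_edgeFaces : ∅ ∉ edgeFaces f := fun h => by
  have := edgeRank_pos h
  rw [edgeRank_empty] at this
  omega

/-- Within either kind of face the vertex set must grow. From bipartite to non-bipartite the
correction term disappears even if the vertex set stays the same. A non-bipartite graph cannot lie
in a bipartite one. -/
theorem edgeRank_lt (hF : F ∈ edgeFaces f) (hG : G ∈ edgeFaces f) (h : F < G) :
    edgeRank F < edgeRank G := by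
  have hsupp := edgeSupport_mono h.le
  rcases mem_edgeFaces.1 hF with ⟨k, A, B, hA, hB, hAk, hBk, rfl⟩ | ⟨T, hT, rfl⟩ <;>
  rcases mem_edgeFaces.1 hG with ⟨l, C, D, hC, hD, hCl, hDl, rfl⟩ | ⟨U, hU, rfl⟩
  · have h1 := disjoint_of_class hAk hBk
    have h2 := disjoint_of_class hCl hDl
    rw [edgeSupport_biclique hA hB, edgeSupport_biclique hC hD] at hsupp
    rw [edgeRank_biclique hA hB h1, edgeRank_biclique hC hD h2]
    have h3 := Finset.card_le_card hsupp
    have h4 : (A ∪ B).card ≠ (C ∪ D).card := fun h4 =>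
      h.ne (biclique_eq_of_subset hA hB h2 h.le (Finset.eq_of_subset_of_card_le hsupp h4.ge))
    rw [Finset.card_union_of_disjoint h1, Finset.card_union_of_disjoint h2] at h3 h4
    have := hA.card_pos
    have := hB.card_pos
    omega
  · have h1 := disjoint_of_class hAk hBk
    rw [edgeSupport_biclique hA hB, hU.edgeSupport_eq] at hsupp
    rw [edgeRank_biclique hA hB h1, hU.edgeRank_eq]
    have h3 := Finset.card_le_card hsupp
    rw [Finset.card_union_of_disjoint h1] at h3
    have := hA.card_pos
    omega
  · exact absurd ((isBip_biclique (disjoint_of_class hCl hDl)).mono h.le) hT.not_isBip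
  · rw [hT.edgeSupport_eq, hU.edgeSupport_eq] at hsupp
    rw [hT.edgeRank_eq, hU.edgeRank_eq]
    refine Finset.card_lt_card (lt_of_le_of_ne hsupp ?_)
    rintro rfl
    exact lt_irrefl _ h

theorem edgeRank_strictMono (F : Finset (V × V)) (hF : F = ∅ ∨ F ∈ edgeFaces f)
    (G : Finset (V × V)) (hG : G = ∅ ∨ G ∈ edgeFaces f) (h : F < G) :
    edgeRank F < edgeRank G := by
  rcases hG with rfl | hG
  · exact absurd h not_lt_bot
  · rcases hF with rfl | hF
    · rw [edgeRank_empty]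
      exact edgeRank_pos hG
    · exact edgeRank_lt hF hG h

/-- In a biclique, delete a vertex from a part with at least two vertices; a single edge has rank
one and covers the empty face. In a face meeting three classes, keep only the edges between one
class and the rest: the vertices are unchanged, but the graph becomes bipartite. -/
theorem exists_edgeRank_pred (hF : F ∈ edgeFaces f) :
    ∃ G, (G = ∅ ∨ G ∈ edgeFaces f) ∧ G < F ∧ edgeRank G + 1 = edgeRank F := by
  classical
  rcases mem_edgeFaces.1 hF with ⟨k, A, B, hA, hB, hAk, hBk, rfl⟩ | ⟨T, hT, rfl⟩
  · have hAB := disjoint_of_class hAk hBk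
    have hA' := hA.card_pos
    have hB' := hB.card_pos
    have step : ∀ C D : Finset V, C ⊆ A → D ⊆ B → C.Nonempty → D.Nonempty →
        C.card + D.card + 1 = A.card + B.card →
        ∃ G, (G = ∅ ∨ G ∈ edgeFaces f) ∧ G < biclique A B ∧
          edgeRank G + 1 = edgeRank (biclique A B) := by
      intro C D hCA hDB hC hD hcard
      have hCD : Disjoint C D := hAB.mono hCA hDB
      have hC' := hC.card_pos
      have hr : edgeRank (biclique C D) + 1 = edgeRank (biclique A B) := by
        rw [edgeRank_biclique hC hD hCD, edgeRank_biclique hA hB hAB]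
        omega
      refine ⟨biclique C D, Or.inr (mem_edgeFaces.2 (Or.inl ⟨k, C, D, hC, hD,
        fun x hx => hAk x (hCA hx), fun x hx => hBk x (hDB hx), rfl⟩)), lt_of_le_of_ne ?_ ?_, hr⟩
      · intro p hp
        rw [mem_biclique] at hp ⊢
        exact hp.imp (And.imp (@hCA _) (@hDB _)) (And.imp (@hDB _) (@hCA _))
      · intro h
        rw [h] at hr
        omega
    by_cases h1 : 2 ≤ A.card
    · obtain ⟨x, hx⟩ := hA
      have := Finset.card_erase_of_mem hx
      exact step (A.erase x) B (Finset.erase_subset _ _) subset_rfl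
        (Finset.card_pos.1 (by omega)) hB (by omega)
    by_cases h2 : 2 ≤ B.card
    · obtain ⟨x, hx⟩ := hB
      have := Finset.card_erase_of_mem hx
      exact step A (B.erase x) subset_rfl (Finset.erase_subset _ _) hA
        (Finset.card_pos.1 (by omega)) (by omega)
    refine ⟨∅, Or.inl rfl, ?_, ?_⟩
    · refine bot_lt_iff_ne_bot.2 ?_
      obtain ⟨x, hx⟩ := hA
      obtain ⟨y, hy⟩ := hB
      exact Finset.ne_empty_of_mem (a := (x, y)) (mem_biclique.2 (Or.inl ⟨hx, hy⟩))
    · rw [edgeRank_empty, edgeRank_biclique hA hB hAB]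
      omega
  · have hT' := hT
    obtain ⟨x, hx, y, hy, z, hz, hxy, hxz, hyz⟩ := hT
    have hA : (T.filter (f · = f x)).Nonempty := ⟨x, by simp [hx]⟩
    have hB : (T.filter (f · ≠ f x)).Nonempty := ⟨y, by simp [hy, hxy.symm]⟩
    have hcard : (T.filter (f · = f x)).card + (T.filter (f · ≠ f x)).card = T.card :=
      Finset.card_filter_add_card_filter_not _
    refine ⟨biclique (T.filter (f · = f x)) (T.filter (f · ≠ f x)), Or.inr (mem_edgeFaces.2
      (Or.inl ⟨f x, _, _, hA, hB, by simp, by simp, rfl⟩)), lt_of_le_of_ne ?_ ?_, ?_⟩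
    · intro p hp
      rw [mem_biclique] at hp
      simp only [Finset.mem_filter] at hp
      rw [mem_multipartite]
      rcases hp with ⟨⟨h1, h2⟩, h3, h4⟩ | ⟨⟨h1, h2⟩, h3, h4⟩
      · exact ⟨h1, h3, fun h => h4 (h ▸ h2)⟩
      · exact ⟨h1, h3, fun h => h2 (h.trans h4)⟩
    · intro h
      refine hT'.not_isBip (h ▸ isBip_biclique ?_)
      exact Finset.disjoint_filter_filter_not _ _ _
    · rw [hT'.edgeRank_eq, edgeRank_biclique hA hB (Finset.disjoint_filter_filter_not _ _ _)]
      have := hA.card_pos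
      omega

omit [Fintype V] [DecidableEq V] in
/-- If a weight on vertices has its maximum over the pairs of vertices with different labels at
`(i, j)`, then there are only two possibilities. -/
theorem weight_cases {w : V → ℝ} {i j : V} (hij : f i ≠ f j)
    (hmax : ∀ q : V × V, f q.1 ≠ f q.2 → w q.1 + w q.2 ≤ w i + w j) :
    ((∀ x, f x = f i → w x ≤ w i) ∧ (∀ x, f x ≠ f i → w x ≤ w j)) ∧
      (w j = w i → ∀ x, w x ≤ w i) := by
  have h1 : ∀ x, f x = f i → w x ≤ w i := fun x hx => by
    have := hmax (x, j) (by simpa [hx] using hij)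
    simp only at this
    linarith
  have h2 : ∀ x, f x ≠ f i → w x ≤ w j := fun x hx => by
    have := hmax (x, i) hx
    simp only at this
    linarith
  refine ⟨⟨h1, h2⟩, fun h x => ?_⟩
  by_cases hx : f x = f i
  · exact h1 x hx
  · exact h ▸ h2 x hx

/-- Take a maximizing pair `(i, j)` with `w j ≤ w i`. If the inequality is strict, every maximizing
pair joins a vertex of weight `w i` in the class of `i` to a vertex of weight `w j` outside it,
which gives a biclique. If the weights are equal, both ends of any maximizing pair have the overall
maximal weight, which gives a complete multipartite graph. -/
theorem mem_edgeFaces_of_maximizers {w : V → ℝ} (hF : F.Nonempty)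
    (h : ∀ p, p ∈ F ↔ f p.1 ≠ f p.2 ∧ ∀ q : V × V, f q.1 ≠ f q.2 → w q.1 + w q.2 ≤ w p.1 + w p.2) :
    F ∈ edgeFaces f := by
  classical
  obtain ⟨i, j, hi, hij, hw, hmax⟩ : ∃ i j, (i, j) ∈ F ∧ f i ≠ f j ∧ w j ≤ w i ∧
      ∀ q : V × V, f q.1 ≠ f q.2 → w q.1 + w q.2 ≤ w i + w j := by
    obtain ⟨⟨i, j⟩, hp⟩ := hF
    have hp' := (h _).1 hp
    rcases le_total (w j) (w i) with hw | hw
    · exact ⟨i, j, hp, hp'.1, hw, hp'.2⟩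
    · have h2 : ∀ q : V × V, f q.1 ≠ f q.2 → w q.1 + w q.2 ≤ w j + w i := fun q hq => by
        rw [add_comm (w j)]
        exact hp'.2 q hq
      exact ⟨j, i, (h _).2 ⟨hp'.1.symm, h2⟩, hp'.1.symm, hw, h2⟩
  have hF' : ∀ x y, (x, y) ∈ F ↔ f x ≠ f y ∧ w x + w y = w i + w j := by
    intro x y
    rw [h]
    simp only
    refine and_congr_right fun hxy => ⟨fun h1 => ?_, fun h1 q hq => h1 ▸ hmax q hq⟩
    exact le_antisymm (hmax (x, y) hxy) (h1 (i, j) hij)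
  obtain ⟨⟨h1, h2⟩, h3⟩ := weight_cases hij hmax
  rcases hw.lt_or_eq with hlt | heq
  · refine mem_edgeFaces.2 (Or.inl ⟨f i, Finset.univ.filter fun x => f x = f i ∧ w x = w i,
      Finset.univ.filter fun x => f x ≠ f i ∧ w x = w j, ⟨i, by simp⟩, ⟨j, by simp [hij.symm]⟩,
      by simp +contextual, by simp +contextual, ?_⟩)
    ext ⟨x, y⟩
    rw [hF', mem_biclique]
    simp only [Finset.mem_filter, Finset.mem_univ, true_and]
    constructor
    · rintro ⟨hxy, hsum⟩
      by_cases hx : f x = f i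
      · have hy : f y ≠ f i := fun h => hxy (hx.trans h.symm)
        have := h1 x hx
        have := h2 y hy
        exact Or.inl ⟨⟨hx, by linarith⟩, hy, by linarith⟩
      · have := h2 x hx
        by_cases hy : f y = f i
        · have := h1 y hy
          exact Or.inr ⟨⟨hx, by linarith⟩, hy, by linarith⟩
        · have := h2 y hy
          linarith
    · rintro (⟨⟨hx, hx'⟩, hy, hy'⟩ | ⟨⟨hx, hx'⟩, hy, hy'⟩)
      · exact ⟨fun h => hy (h ▸ hx), by linarith⟩
      · exact ⟨fun h => hx (h.trans hy), by linarith⟩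
  · have hE : F = multipartite f (Finset.univ.filter fun x => w x = w i) := by
      ext ⟨x, y⟩
      rw [hF', mem_multipartite]
      simp only [Finset.mem_filter, Finset.mem_univ, true_and]
      have := h3 heq x
      have := h3 heq y
      constructor
      · rintro ⟨hxy, hsum⟩
        exact ⟨by linarith, by linarith, hxy⟩
      · rintro ⟨hx, hy, hxy⟩
        exact ⟨hxy, by linarith⟩
    rw [hE]
    exact multipartite_mem_edgeFaces (x := i) (y := j) (by simp) (by simp [heq]) hij

theorem exists_weight_of_mem_edgeFaces (hF : F ∈ edgeFaces f) :
    F.Nonempty ∧ ∃ w : V → ℝ, ∀ p, p ∈ F ↔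
      f p.1 ≠ f p.2 ∧ ∀ q : V × V, f q.1 ≠ f q.2 → w q.1 + w q.2 ≤ w p.1 + w p.2 := by
  classical
  suffices H : F.Nonempty ∧ ∃ w : V → ℝ, ∃ r : ℝ, (∀ q : V × V, f q.1 ≠ f q.2 → w q.1 + w q.2 ≤ r) ∧
      ∀ p, p ∈ F ↔ f p.1 ≠ f p.2 ∧ w p.1 + w p.2 = r by
    obtain ⟨⟨p₀, hp₀⟩, w, r, h1, h2⟩ := H
    refine ⟨⟨p₀, hp₀⟩, w, fun p => ?_⟩
    rw [h2]
    refine and_congr_right fun hp => ⟨fun h q hq => h ▸ h1 q hq, fun h => ?_⟩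
    have h3 := (h2 p₀).1 hp₀
    exact le_antisymm (h1 p hp) (h3.2 ▸ h p₀ h3.1)
  rcases mem_edgeFaces.1 hF with ⟨k, A, B, ⟨x, hx⟩, ⟨y, hy⟩, hAk, hBk, rfl⟩ | ⟨T, hT, rfl⟩
  -- No pair lies inside `A`, since `A` is contained in the class `k`. So the maximum is 1, and it
  -- requires one end in `A` and an end of weight 0 outside the class `k`, that is, in `B`.
  · refine ⟨⟨(x, y), mem_biclique.2 (Or.inl ⟨hx, hy⟩)⟩,
      fun z => if z ∈ A then 1 else if z ∈ B ∨ f z = k then 0 else -1, 1, ?_, ?_⟩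
    · rintro ⟨u, z⟩ huz
      simp only at huz ⊢
      by_cases hu : u ∈ A <;> by_cases hz : z ∈ A
      · exact absurd ((hAk u hu).trans (hAk z hz).symm) huz
      all_goals
        simp only [hu, hz, if_true, if_false]
        split_ifs <;> norm_num
    · rintro ⟨u, z⟩
      rw [mem_biclique]
      simp only
      have d1 : u ∈ A → u ∉ B := fun h1 h2 => hBk u h2 (hAk u h1)
      have d2 : z ∈ A → z ∉ B := fun h1 h2 => hBk z h2 (hAk z h1)
      have e1 : u ∈ A → f u = k := hAk u
      have e2 : z ∈ A → f z = k := hAk z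
      have e3 : u ∈ B → f u ≠ k := hBk u
      have e4 : z ∈ B → f z ≠ k := hBk z
      constructor
      · rintro (⟨h1, h2⟩ | ⟨h1, h2⟩)
        · have : z ∉ A := fun h => d2 h h2
          refine ⟨fun h => e4 h2 (h ▸ e1 h1), ?_⟩
          simp [h1, h2, this]
        · have : u ∉ A := fun h => d1 h h1
          refine ⟨fun h => e3 h1 (h ▸ e2 h2), ?_⟩
          simp [h1, h2, this]
      · rintro ⟨hne, hs⟩
        by_cases hu : u ∈ A <;> by_cases hz : z ∈ A
        · exact absurd ((e1 hu).trans (e2 hz).symm) hne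
        · have hzk : f z ≠ k := fun h => hne ((e1 hu).trans h.symm)
          by_cases hzB : z ∈ B
          · exact Or.inl ⟨hu, hzB⟩
          · simp only [hu, hz, hzk, hzB, if_true, if_false, or_self] at hs
            norm_num at hs
        · have huk : f u ≠ k := fun h => hne (h.trans (e2 hz).symm)
          by_cases huB : u ∈ B
          · exact Or.inr ⟨huB, hz⟩
          · simp only [hu, hz, huk, huB, if_true, if_false, or_self] at hs
            norm_num at hs
        · simp only [hu, hz, if_false] at hs
          split_ifs at hs <;> norm_num at hs
  · obtain ⟨x, hx, y, hy, -, -, hxy, -⟩ := hT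
    refine ⟨⟨(x, y), mem_multipartite.2 ⟨hx, hy, hxy⟩⟩, fun z => if z ∈ T then 1 else 0, 2, ?_, ?_⟩
    · rintro ⟨u, z⟩ -
      simp only
      split_ifs <;> norm_num
    · rintro ⟨u, z⟩
      rw [mem_multipartite]
      simp only
      by_cases hu : u ∈ T <;> by_cases hz : z ∈ T <;> (simp [hu, hz]; try norm_num)

end EdgeSets

end CDIndex

namespace CDIndex

/-! ### Merging classes, and the faces cut by the splitting hyperplane -/

section Split

variable {V κ : Type*} [DecidableEq V]

/-- `S` is a union of classes of `f`, and the classes of `g` are `S` and the classes of `f`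
outside of `S`. -/
structure Merges (S : Finset V) (f g : V → κ) : Prop where
  compat : ∀ x y, f x = f y → x ∈ S → y ∈ S
  eq_iff : ∀ x y, g x = g y ↔ f x = f y ∨ (x ∈ S ∧ y ∈ S)

/-- The classes of `h` are `S` and its complement. -/
def IsBipartition (S : Finset V) (h : V → κ) : Prop := ∀ x y, h x = h y ↔ (x ∈ S ↔ y ∈ S)

/-- `T` meets at least two classes inside of `S` and at least two classes outside of `S`. -/
def IsSplit (f : V → κ) (S T : Finset V) : Prop :=
  (∃ x ∈ T, ∃ y ∈ T, x ∈ S ∧ y ∈ S ∧ f x ≠ f y) ∧ ∃ x ∈ T, ∃ y ∈ T, x ∉ S ∧ y ∉ S ∧ f x ≠ f y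

/-- No edge of `F` is contained in `S`. -/
def Avoids (S : Finset V) (F : Finset (V × V)) : Prop := ∀ p ∈ F, ¬ (p.1 ∈ S ∧ p.2 ∈ S)

variable {S T U : Finset V} {f g h : V → κ} {F G : Finset (V × V)}

omit [DecidableEq V] in
theorem Avoids.mono (hFG : F ⊆ G) (hG : Avoids S G) : Avoids S F := fun p hp => hG p (hFG hp)

omit [DecidableEq V] in
theorem IsSplit.mono (hU : IsSplit f S U) (hUT : U ⊆ T) : IsSplit f S T := by
  obtain ⟨⟨x, hx, y, hy, h1⟩, u, hu, v, hv, h2⟩ := hU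
  exact ⟨⟨x, hUT hx, y, hUT hy, h1⟩, u, hUT hu, v, hUT hv, h2⟩

theorem isSplit_compl [Fintype V] : IsSplit f Sᶜ T ↔ IsSplit f S T := by
  simp only [IsSplit, Finset.mem_compl, not_not]
  exact and_comm

theorem IsBipartition.compl [Fintype V] (hh : IsBipartition S h) : IsBipartition Sᶜ h := by
  intro x y
  rw [hh x y, Finset.mem_compl, Finset.mem_compl, not_iff_not]

/-- The section by the hyperplane is reached by two successive merges, of `S` and then of its
complement, so results about a single merge also describe the section. -/
theorem Merges.bipartition [Fintype V] (hg : Merges S f g) (hh : IsBipartition S h) :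
    Merges Sᶜ g h := by
  refine ⟨fun x y hxy hx => ?_, fun x y => ?_⟩
  · rw [Finset.mem_compl] at hx ⊢
    rcases (hg.eq_iff x y).1 hxy with h1 | h1
    · exact fun hy => hx (hg.compat y x h1.symm hy)
    · exact absurd h1.1 hx
  · rw [hh x y, hg.eq_iff, Finset.mem_compl, Finset.mem_compl]
    have h1 := hg.compat x y
    have h2 := hg.compat y x
    have h3 : f x = f y ↔ f y = f x := eq_comm
    tauto

theorem Merges.not_isSplit [Fintype V] (hg : Merges S f g) : ¬ IsSplit g Sᶜ U := by
  rintro ⟨-, x, -, y, -, hx, hy, hxy⟩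
  rw [Finset.mem_compl, not_not] at hx hy
  exact hxy ((hg.eq_iff x y).2 (Or.inr ⟨hx, hy⟩))

omit [DecidableEq V] in
theorem mem_multipartite_bipartition (hh : IsBipartition S h) {p : V × V} :
    p ∈ multipartite h U ↔ p.1 ∈ U ∧ p.2 ∈ U ∧ ¬ (p.1 ∈ S ↔ p.2 ∈ S) := by
  rw [mem_multipartite, Ne, hh]

theorem multipartite_bipartition (hh : IsBipartition S h) :
    multipartite h U = biclique (U ∩ S) (U \ S) := by
  ext p
  rw [mem_multipartite_bipartition hh, mem_biclique]
  simp only [Finset.mem_inter, Finset.mem_sdiff]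
  tauto

omit [DecidableEq V] in
theorem Merges.ne (hg : Merges S f g) {x y : V} (hx : x ∈ S) (hy : y ∉ S) : f x ≠ f y :=
  fun h => hy (hg.compat x y h hx)

omit [DecidableEq V] in
theorem Merges.ne' (hg : Merges S f g) {x y : V} (hx : x ∈ S) (hy : y ∉ S) : g x ≠ g y := by
  rw [Ne, hg.eq_iff]
  exact fun h => h.elim (hg.ne hx hy) fun h => hy h.2

omit [DecidableEq V] in
theorem Merges.ne_of_notMem (hg : Merges S f g) {x y : V} (hx : x ∉ S) (h : f x ≠ f y) :
    g x ≠ g y := by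
  rw [Ne, hg.eq_iff]
  exact fun h' => h'.elim h fun h => hx h.1

omit [DecidableEq V] in
theorem Merges.meetsThree (hg : Merges S f g) (hU : IsSplit f S U) : MeetsThree f U := by
  obtain ⟨⟨x, hx, -, -, hxS, -⟩, u, hu, v, hv, huS, hvS, huv⟩ := hU
  exact ⟨x, hx, u, hu, v, hv, hg.ne hxS huS, hg.ne hxS hvS, huv⟩

omit [DecidableEq V] in
theorem Merges.meetsThree' (hg : Merges S f g) (hU : IsSplit f S U) : MeetsThree g U := by
  obtain ⟨⟨x, hx, -, -, hxS, -⟩, u, hu, v, hv, huS, hvS, huv⟩ := hU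
  exact ⟨x, hx, u, hu, v, hv, hg.ne' hxS huS, hg.ne' hxS hvS, hg.ne_of_notMem huS huv⟩

omit [DecidableEq V] in
theorem IsSplit.not_avoids (hU : IsSplit f S U) : ¬ Avoids S (multipartite f U) := by
  obtain ⟨⟨x, hx, y, hy, hxS, hyS, hxy⟩, -⟩ := hU
  exact fun h => h (x, y) (mem_multipartite.2 ⟨hx, hy, hxy⟩) ⟨hxS, hyS⟩

omit [DecidableEq V] in
theorem Merges.avoids (hg : Merges S f g) : Avoids S (multipartite g U) := fun _ hp h =>
  (mem_multipartite.1 hp).2.2 ((hg.eq_iff _ _).2 (Or.inr h))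

omit [DecidableEq V] in
theorem IsBipartition.avoids (hh : IsBipartition S h) : Avoids S (multipartite h U) :=
  fun _ hp hS => ((mem_multipartite_bipartition hh).1 hp).2.2 (iff_of_true hS.1 hS.2)

omit [DecidableEq V] in
theorem Merges.multipartite_subset (hg : Merges S f g) :
    multipartite g U ⊆ multipartite f U := fun p hp => by
  rw [mem_multipartite] at hp ⊢
  exact ⟨hp.1, hp.2.1, fun h => hp.2.2 ((hg.eq_iff _ _).2 (Or.inl h))⟩

omit [DecidableEq V] in
theorem Merges.multipartite_bipartition_subset (hg : Merges S f g) (hh : IsBipartition S h) :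
    multipartite h U ⊆ multipartite g U := fun p hp => by
  rw [mem_multipartite_bipartition hh] at hp
  rw [mem_multipartite]
  refine ⟨hp.1, hp.2.1, ?_⟩
  by_cases h1 : p.1 ∈ S
  · exact hg.ne' h1 fun h2 => hp.2.2 (iff_of_true h1 h2)
  · have h2 : p.2 ∈ S := by
      by_contra h2
      exact hp.2.2 (iff_of_false h1 h2)
    exact (hg.ne' h2 h1).symm

theorem IsSplit.edgeSupport_bipartition (hU : IsSplit f S U) (hh : IsBipartition S h) :
    edgeSupport (multipartite h U) = U := by
  obtain ⟨⟨x, hx, -, -, hxS, -⟩, u, hu, -, -, huS, -⟩ := hU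
  exact edgeSupport_multipartite hx hu (by simp [hh x u, hxS, huS])

omit [DecidableEq V] in
theorem multipartite_mono (hUT : U ⊆ T) : multipartite f U ⊆ multipartite f T := fun p hp => by
  rw [mem_multipartite] at hp ⊢
  exact ⟨hUT hp.1, hUT hp.2.1, hp.2.2⟩

theorem isBip_bipartition (hh : IsBipartition S h) : IsBip (multipartite h U) := by
  rw [multipartite_bipartition hh]
  exact isBip_biclique (Finset.disjoint_left.2 fun x h1 h2 =>
    (Finset.mem_sdiff.1 h2).2 (Finset.mem_inter.1 h1).2)

theorem IsSplit.edgeRank_bipartition (hU : IsSplit f S U) (hh : IsBipartition S h) :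
    edgeRank (multipartite h U) = U.card - 1 := by
  rw [edgeRank, hU.edgeSupport_bipartition hh, if_pos (isBip_bipartition hh)]

variable [Fintype V]

/-- A face that contains the bipartite part of a split face is split itself. -/
theorem exists_eq_multipartite (hh : IsBipartition S h) (hU : IsSplit f S U)
    (hF : F ∈ edgeFaces f) (hUF : multipartite h U ⊆ F) :
    ∃ T, U ⊆ T ∧ F = multipartite f T := by
  obtain ⟨⟨x, hx, y, hy, hxS, hyS, hxy⟩, u, hu, v, hv, huS, hvS, huv⟩ := hU
  have key : ∀ s ∈ U, ∀ t ∈ U, s ∈ S → t ∉ S → (s, t) ∈ F := fun s hs t ht hsS htS =>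
    hUF ((mem_multipartite_bipartition hh).2 ⟨hs, ht, by simp [hsS, htS]⟩)
  rcases mem_edgeFaces.1 hF with ⟨k, A, B, -, -, hA, hB, rfl⟩ | ⟨T, -, rfl⟩
  · exfalso
    rcases mem_biclique.1 (key x hx u hu hxS huS) with ⟨h1, h2⟩ | ⟨h1, h2⟩
    · rcases mem_biclique.1 (key y hy u hu hyS huS) with ⟨h3, h4⟩ | ⟨h3, h4⟩
      · exact hxy ((hA x h1).trans (hA y h3).symm)
      · exact hB u h2 (hA u h4)
    · rcases mem_biclique.1 (key x hx v hv hxS hvS) with ⟨h3, h4⟩ | ⟨h3, h4⟩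
      · exact hB x h1 (hA x h3)
      · exact huv ((hA u h2).trans (hA v h4).symm)
  · refine ⟨T, fun z hz => ?_, rfl⟩
    by_cases hzS : z ∈ S
    · exact (mem_multipartite.1 (key z hz u hu hzS huS)).1
    · exact (mem_multipartite.1 (key x hx z hz hxS hzS)).2.1

/-- A face that contains the section of a cut face is itself cut. This keeps the faces created by
the split apart from the faces that survive it. -/
theorem not_avoids_of_subset (hh : IsBipartition S h) (hU : IsSplit f S U)
    (hF : F ∈ edgeFaces f) (hUF : multipartite h U ⊆ F) : ¬ Avoids S F := by
  obtain ⟨T, hT, rfl⟩ := exists_eq_multipartite hh hU hF hUF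
  exact (hU.mono hT).not_avoids

/-- The faces of the part of the polytope on one side of the hyperplane. -/
theorem Merges.mem_edgeFaces_iff (hg : Merges S f g) (hh : IsBipartition S h) :
    F ∈ edgeFaces g ↔ (F ∈ edgeFaces f ∧ Avoids S F) ∨
      ∃ U, IsSplit f S U ∧ (F = multipartite g U ∨ F = multipartite h U) := by
  constructor
  · intro hF
    rcases mem_edgeFaces.1 hF with ⟨k, A, B, ⟨x, hx⟩, ⟨u, hu⟩, hA, hB, rfl⟩ | ⟨T, hT, rfl⟩
    · have hA' : ∀ y ∈ A, g y = g x := fun y hy => (hA y hy).trans (hA x hx).symm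
      have hB' : ∀ y ∈ B, g y ≠ g x := fun y hy => hA x hx ▸ hB y hy
      by_cases hxS : x ∈ S
      · have hAS : ∀ y ∈ A, y ∈ S := fun y hy => by
          by_contra hyS
          exact hg.ne' hxS hyS (hA' y hy).symm
        have hBS : ∀ y ∈ B, y ∉ S := fun y hy hyS =>
          hB' y hy ((hg.eq_iff y x).2 (Or.inr ⟨hyS, hxS⟩))
        have hav : Avoids S (biclique A B) := by
          rintro p hp ⟨h1, h2⟩
          rcases mem_biclique.1 hp with ⟨-, h3⟩ | ⟨h3, -⟩
          · exact hBS _ h3 h2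
          · exact hBS _ h3 h1
        -- Here `A` lies in `S` and `B` outside. If either part lies in one class of `f`, the
        -- biclique was already a face before the merge. Otherwise both parts meet two classes, and
        -- it is the section of the cut face on `A ∪ B`.
        by_cases h1 : ∀ y ∈ A, f y = f x
        · exact Or.inl ⟨mem_edgeFaces.2 (Or.inl ⟨f x, A, B, ⟨x, hx⟩, ⟨u, hu⟩, h1,
            fun y hy => (hg.ne hxS (hBS y hy)).symm, rfl⟩), hav⟩
        by_cases h2 : ∀ y ∈ B, f y = f u
        · exact Or.inl ⟨mem_edgeFaces.2 (Or.inl ⟨f u, B, A, ⟨u, hu⟩, ⟨x, hx⟩, h2,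
            fun y hy => hg.ne (hAS y hy) (hBS u hu), biclique_comm⟩), hav⟩
        push Not at h1 h2
        obtain ⟨y, hy, hyx⟩ := h1
        obtain ⟨v, hv, hvu⟩ := h2
        refine Or.inr ⟨A ∪ B, ⟨⟨y, by simp [hy], x, by simp [hx], hAS y hy, hxS, hyx⟩,
          v, by simp [hv], u, by simp [hu], hBS v hv, hBS u hu, hvu⟩, Or.inr ?_⟩
        rw [multipartite_bipartition hh]
        congr 1
        · ext z
          have := hAS z
          have := hBS z
          simp only [Finset.mem_inter, Finset.mem_union]
          tauto
        · ext z
          have := hAS z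
          have := hBS z
          simp only [Finset.mem_sdiff, Finset.mem_union]
          tauto
      · have h1 : ∀ y ∈ A, f y = f x := fun y hy =>
          ((hg.eq_iff y x).1 (hA' y hy)).resolve_right fun h => hxS h.2
        refine Or.inl ⟨mem_edgeFaces.2 (Or.inl ⟨f x, A, B, ⟨x, hx⟩, ⟨u, hu⟩, h1,
          fun y hy h => hB' y hy ((hg.eq_iff y x).2 (Or.inl h)), rfl⟩), ?_⟩
        have hAS : ∀ y ∈ A, y ∉ S := fun y hy hyS => hxS (hg.compat y x (h1 y hy) hyS)
        rintro p hp ⟨h1, h2⟩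
        rcases mem_biclique.1 hp with ⟨h3, -⟩ | ⟨-, h3⟩
        · exact hAS _ h3 h1
        · exact hAS _ h3 h2
    · obtain ⟨x, hx, y, hy, z, hz, hxy, hxz, hyz⟩ := hT
      -- `S` is a single class of `g`, so among three classes of `g` at least two lie outside `S`.
      -- If `T` also meets two old classes inside `S`, it is cut; if not, merging does not affect
      -- its edges.
      by_cases h1 : ∃ p ∈ T, ∃ q ∈ T, p ∈ S ∧ q ∈ S ∧ f p ≠ f q
      · refine Or.inr ⟨T, ⟨h1, ?_⟩, Or.inl rfl⟩
        rw [Ne, hg.eq_iff, not_or] at hxy hxz hyz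
        by_cases hxS : x ∈ S
        · exact ⟨y, hy, z, hz, fun h => hxy.2 ⟨hxS, h⟩, fun h => hxz.2 ⟨hxS, h⟩, hyz.1⟩
        · by_cases hyS : y ∈ S
          · exact ⟨x, hx, z, hz, hxS, fun h => hyz.2 ⟨hyS, h⟩, hxz.1⟩
          · exact ⟨x, hx, y, hy, hxS, hyS, hxy.1⟩
      · push Not at h1
        have hE : multipartite g T = multipartite f T := by
          refine hg.multipartite_subset.antisymm fun p hp => ?_
          rw [mem_multipartite] at hp ⊢
          refine ⟨hp.1, hp.2.1, fun h => ?_⟩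
          rcases (hg.eq_iff _ _).1 h with h2 | h2
          · exact hp.2.2 h2
          · exact hp.2.2 (h1 _ hp.1 _ hp.2.1 h2.1 h2.2)
        refine Or.inl ⟨?_, hg.avoids⟩
        rw [hE]
        exact multipartite_mem_edgeFaces hx hy fun h => hxy ((hg.eq_iff x y).2 (Or.inl h))
  · rintro (⟨hF, hav⟩ | ⟨U, hU, rfl | rfl⟩)
    · rcases mem_edgeFaces.1 hF with ⟨k, A, B, ⟨x, hx⟩, hB, hA, hBk, rfl⟩ | ⟨T, hT, rfl⟩
      · refine mem_edgeFaces.2 (Or.inl ⟨g x, A, B, ⟨x, hx⟩, hB,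
          fun y hy => (hg.eq_iff y x).2 (Or.inl ((hA y hy).trans (hA x hx).symm)),
          fun y hy h => ?_, rfl⟩)
        rcases (hg.eq_iff y x).1 h with h1 | h1
        · exact hBk y hy (h1.trans (hA x hx))
        · exact hav (x, y) (mem_biclique.2 (Or.inl ⟨hx, hy⟩)) ⟨h1.2, h1.1⟩
      · have key : ∀ y ∈ T, ∀ z ∈ T, f y ≠ f z → g y ≠ g z := fun y hy z hz hyz h =>
          ((hg.eq_iff y z).1 h).elim hyz (hav (y, z) (mem_multipartite.2 ⟨hy, hz, hyz⟩))
        have hE : multipartite f T = multipartite g T := by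
          refine subset_antisymm (fun p hp => ?_) hg.multipartite_subset
          rw [mem_multipartite] at hp ⊢
          exact ⟨hp.1, hp.2.1, key _ hp.1 _ hp.2.1 hp.2.2⟩
        obtain ⟨x, hx, y, hy, -, -, hxy, -⟩ := hT
        rw [hE]
        exact multipartite_mem_edgeFaces hx hy (key x hx y hy hxy)
    · exact mem_edgeFaces.2 (Or.inr ⟨U, hg.meetsThree' hU, rfl⟩)
    · obtain ⟨⟨x, hx, -, -, hxS, -⟩, u, hu, -, -, huS, -⟩ := hU
      refine mem_edgeFaces.2 (Or.inl ⟨g x, U ∩ S, U \ S, ⟨x, by simp [hx, hxS]⟩,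
        ⟨u, by simp [hu, huS]⟩, fun y hy => ?_, fun y hy => ?_, multipartite_bipartition hh⟩)
      · exact (hg.eq_iff y x).2 (Or.inr ⟨(Finset.mem_inter.1 hy).2, hxS⟩)
      · exact (hg.ne' hxS (Finset.mem_sdiff.1 hy).2).symm

/-- The faces of the intersection of the polytope with the hyperplane. -/
theorem Merges.mem_edgeFaces_bipartition_iff (hg : Merges S f g) (hh : IsBipartition S h) :
    F ∈ edgeFaces h ↔ (F ∈ edgeFaces f ∧ Avoids S F ∧ Avoids Sᶜ F) ∨
      ∃ U, IsSplit f S U ∧ F = multipartite h U := by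
  -- The second merge creates no new faces: nothing is cut, because `S` is already a single class of
  -- `g` (`Merges.not_isSplit`).
  rw [(hg.bipartition hh).mem_edgeFaces_iff hh.compl, hg.mem_edgeFaces_iff hh]
  constructor
  · rintro (⟨⟨h1, h2⟩ | ⟨U, hU, rfl | rfl⟩, h3⟩ | ⟨U, hU, -⟩)
    · exact Or.inl ⟨h1, h2, h3⟩
    · obtain ⟨-, u, hu, v, hv, huS, hvS, huv⟩ := hU
      refine absurd ?_ (h3 (u, v) (mem_multipartite.2 ⟨hu, hv, hg.ne_of_notMem huS huv⟩))
      simp [huS, hvS]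
    · exact Or.inr ⟨U, hU, rfl⟩
    · exact absurd hU hg.not_isSplit
  · rintro (⟨h1, h2, h3⟩ | ⟨U, hU, rfl⟩)
    · exact Or.inl ⟨Or.inl ⟨h1, h2⟩, h3⟩
    · exact Or.inl ⟨Or.inr ⟨U, hU, Or.inr rfl⟩, hh.compl.avoids⟩

/-- The faces that lie on one side of the hyperplane are not affected by the split. -/
theorem Merges.chainSum_eq (hg : Merges S f g) (hh : IsBipartition S h) (ρ : Finset (V × V) → ℕ)
    (hF : F ∈ edgeFaces f) (hav : Avoids S F) :
    chainSum (edgeFaces g) ρ F = chainSum (edgeFaces f) ρ F := by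
  refine chainSum_congr ρ ?_
  ext G
  rw [mem_below, mem_below, hg.mem_edgeFaces_iff hh]
  constructor
  · rintro ⟨⟨h1, -⟩ | ⟨U, hU, h1⟩, hGF⟩
    · exact ⟨h1, hGF⟩
    · refine absurd hav (not_avoids_of_subset hh hU hF (Finset.Subset.trans ?_ hGF.le))
      rcases h1 with rfl | rfl
      · exact hg.multipartite_bipartition_subset hh
      · exact subset_rfl
  · rintro ⟨h1, hGF⟩
    exact ⟨Or.inl ⟨h1, hav.mono hGF.le⟩, hGF⟩

end Split

end CDIndex

namespace CDIndex

/-! ### Sums over the faces below a cut face -/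

section SplitFormula

variable {V κ : Type*} [DecidableEq V] [Fintype V]

open Classical in
/-- The proper subsets of `T` that meet two classes inside of `S` and two classes outside. -/
def splitBelow (f : V → κ) (S T : Finset V) : Finset (Finset V) :=
  Finset.univ.filter fun U => U ⊂ T ∧ IsSplit f S U

open Classical in
/-- The faces, below the face given by `T`, that have no edge in `S`. -/
def sideBelow (f : V → κ) (S T : Finset V) : Finset (Finset (V × V)) :=
  (below (edgeFaces f) (multipartite f T)).filter (Avoids S)

variable {S T U : Finset V} {f f₁ f₂ f₀ g h : V → κ} {F G : Finset (V × V)}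

theorem mem_splitBelow : U ∈ splitBelow f S T ↔ U ⊂ T ∧ IsSplit f S U := by
  simp [splitBelow]

theorem mem_sideBelow :
    F ∈ sideBelow f S T ↔ (F ∈ edgeFaces f ∧ F < multipartite f T) ∧ Avoids S F := by
  simp [sideBelow]

theorem splitBelow_compl : splitBelow f Sᶜ T = splitBelow f S T := by
  ext U
  rw [mem_splitBelow, mem_splitBelow, isSplit_compl]

omit [Fintype V] in
theorem IsSplit.multipartite_lt (hg : Merges S f g) (hU : IsSplit f S U) (hUT : U ⊂ T) :
    multipartite f U < multipartite f T := by
  refine lt_of_le_of_ne (multipartite_mono hUT.subset) fun h => ?_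
  have h1 := congrArg edgeSupport h
  rw [(hg.meetsThree hU).edgeSupport_eq, (hg.meetsThree (hU.mono hUT.subset)).edgeSupport_eq] at h1
  exact hUT.ne h1

omit [Fintype V] in
theorem IsSplit.multipartite_lt' (hg : Merges S f g) (hU : IsSplit f S U) (hUT : U ⊂ T) :
    multipartite g U < multipartite g T := by
  refine lt_of_le_of_ne (multipartite_mono hUT.subset) fun h => ?_
  have h1 := congrArg edgeSupport h
  rw [(hg.meetsThree' hU).edgeSupport_eq,
    (hg.meetsThree' (hU.mono hUT.subset)).edgeSupport_eq] at h1
  exact hUT.ne h1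

omit [Fintype V] in
theorem IsSplit.bipartition_lt (hh : IsBipartition S h) (hU : IsSplit f S U) (hUT : U ⊂ T) :
    multipartite h U < multipartite h T := by
  refine lt_of_le_of_ne (multipartite_mono hUT.subset) fun h => ?_
  have h1 := congrArg edgeSupport h
  rw [hU.edgeSupport_bipartition hh, (hU.mono hUT.subset).edgeSupport_bipartition hh] at h1
  exact hUT.ne h1

omit [Fintype V] in
theorem multipartite_ne_bipartition (hg : Merges S f g) (hh : IsBipartition S h)
    (hT : IsSplit f S T) : multipartite h U ≠ multipartite g T := fun h =>
  (hg.meetsThree' hT).not_isBip (h ▸ isBip_bipartition hh)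

omit [Fintype V] in
theorem injOn_multipartite (hg : Merges S f g) :
    Set.InjOn (multipartite f) {U | IsSplit f S U} := fun U hU W hW h => by
  have h1 := congrArg edgeSupport h
  rwa [(hg.meetsThree hU).edgeSupport_eq, (hg.meetsThree hW).edgeSupport_eq] at h1

omit [Fintype V] in
theorem injOn_multipartite' (hg : Merges S f g) :
    Set.InjOn (multipartite g) {U | IsSplit f S U} := fun U hU W hW h => by
  have h1 := congrArg edgeSupport h
  rwa [(hg.meetsThree' hU).edgeSupport_eq, (hg.meetsThree' hW).edgeSupport_eq] at h1

omit [Fintype V] in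
theorem injOn_bipartition (hh : IsBipartition S h) :
    Set.InjOn (multipartite h) {U | IsSplit f S U} := fun U hU W hW h => by
  have h1 := congrArg edgeSupport h
  rwa [IsSplit.edgeSupport_bipartition hU hh, IsSplit.edgeSupport_bipartition hW hh] at h1

/-- A biclique has a part inside one class, which lies in `S` or in the complement, so it cannot
have edges on both sides. Only multipartite faces can be cut. -/
theorem avoids_or_avoids_or_split (hg : Merges S f g) (hF : F ∈ edgeFaces f) :
    Avoids S F ∨ Avoids Sᶜ F ∨ ∃ U, IsSplit f S U ∧ F = multipartite f U := by
  rcases mem_edgeFaces.1 hF with ⟨k, A, B, ⟨x, hx⟩, -, hA, -, rfl⟩ | ⟨T, -, rfl⟩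
  · by_cases hxS : x ∈ S
    · have hAS : ∀ y ∈ A, y ∈ S := fun y hy =>
        hg.compat x y ((hA x hx).trans (hA y hy).symm) hxS
      refine Or.inr (Or.inl ?_)
      rintro p hp ⟨h1, h2⟩
      rw [Finset.mem_compl] at h1 h2
      rcases mem_biclique.1 hp with ⟨h3, -⟩ | ⟨-, h3⟩
      · exact h1 (hAS _ h3)
      · exact h2 (hAS _ h3)
    · have hAS : ∀ y ∈ A, y ∉ S := fun y hy hyS =>
        hxS (hg.compat y x ((hA y hy).trans (hA x hx).symm) hyS)
      left
      rintro p hp ⟨h1, h2⟩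
      rcases mem_biclique.1 hp with ⟨h3, -⟩ | ⟨-, h3⟩
      · exact hAS _ h3 h1
      · exact hAS _ h3 h2
  · by_cases h1 : Avoids S (multipartite f T)
    · exact Or.inl h1
    by_cases h2 : Avoids Sᶜ (multipartite f T)
    · exact Or.inr (Or.inl h2)
    refine Or.inr (Or.inr ⟨T, ?_, rfl⟩)
    unfold Avoids at h1 h2
    push Not at h1 h2
    obtain ⟨p, hp, h3⟩ := h1
    obtain ⟨q, hq, h4⟩ := h2
    rw [mem_multipartite] at hp hq
    rw [Finset.mem_compl, Finset.mem_compl] at h4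
    exact ⟨⟨p.1, hp.1, p.2, hp.2.1, h3.1, h3.2, hp.2.2⟩,
      q.1, hq.1, q.2, hq.2.1, h4.1, h4.2, hq.2.2⟩

/-- Uncut faces are counted on each side by inclusion-exclusion, the intersection being the faces
that lie in the hyperplane. -/
theorem sum_below_split (hg : Merges S f g) (hT : IsSplit f S T)
    (φ : Finset (V × V) → ABPoly) :
    ∑ F ∈ below (edgeFaces f) (multipartite f T), φ F =
      (∑ F ∈ sideBelow f S T, φ F + ∑ F ∈ sideBelow f Sᶜ T, φ F -
        ∑ F ∈ sideBelow f S T ∩ sideBelow f Sᶜ T, φ F) +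
      ∑ U ∈ splitBelow f S T, φ (multipartite f U) := by
  classical
  have hE : below (edgeFaces f) (multipartite f T) =
      (sideBelow f S T ∪ sideBelow f Sᶜ T) ∪ (splitBelow f S T).image (multipartite f) := by
    ext F
    simp only [mem_below, Finset.mem_union, mem_sideBelow, Finset.mem_image, mem_splitBelow]
    constructor
    · rintro ⟨hF, hlt⟩
      rcases avoids_or_avoids_or_split hg hF with h1 | h1 | ⟨U, hU, rfl⟩
      · exact Or.inl (Or.inl ⟨⟨hF, hlt⟩, h1⟩)
      · exact Or.inl (Or.inr ⟨⟨hF, hlt⟩, h1⟩)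
      · refine Or.inr ⟨U, ⟨?_, hU⟩, rfl⟩
        have := edgeSupport_mono hlt.le
        rw [(hg.meetsThree hU).edgeSupport_eq, (hg.meetsThree hT).edgeSupport_eq] at this
        refine lt_of_le_of_ne this ?_
        rintro rfl
        exact lt_irrefl _ hlt
    · rintro ((h1 | h1) | ⟨U, ⟨hUT, hU⟩, rfl⟩)
      · exact h1.1
      · exact h1.1
      · exact ⟨mem_edgeFaces.2 (Or.inr ⟨U, hg.meetsThree hU, rfl⟩), hU.multipartite_lt hg hUT⟩
  rw [hE, Finset.sum_union, Finset.sum_image, ← Finset.sum_union_inter, add_sub_cancel_right]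
  · exact (injOn_multipartite hg).mono fun U hU => (mem_splitBelow.1 hU).2
  · rw [Finset.disjoint_left]
    intro F hF hF'
    obtain ⟨U, hU, rfl⟩ := Finset.mem_image.1 hF'
    have hU' := (mem_splitBelow.1 hU).2
    rcases Finset.mem_union.1 hF with h1 | h1
    · exact hU'.not_avoids (mem_sideBelow.1 h1).2
    · exact (isSplit_compl.2 hU').not_avoids (mem_sideBelow.1 h1).2

/-- Each cut face `U ⊂ T` contributes its half and its section. The face `T` contributes only its
section, which is a new facet of the half. -/
theorem sum_below_side (hg : Merges S f g) (hh : IsBipartition S h) (hT : IsSplit f S T)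
    (φ : Finset (V × V) → ABPoly) :
    ∑ F ∈ below (edgeFaces g) (multipartite g T), φ F =
      ∑ F ∈ sideBelow f S T, φ F + ∑ U ∈ splitBelow f S T, φ (multipartite g U) +
      (φ (multipartite h T) + ∑ U ∈ splitBelow f S T, φ (multipartite h U)) := by
  classical
  have hnT : T ∉ splitBelow f S T := fun h => (mem_splitBelow.1 h).1.ne rfl
  have hE : below (edgeFaces g) (multipartite g T) =
      (sideBelow f S T ∪ (splitBelow f S T).image (multipartite g)) ∪
        (insert T (splitBelow f S T)).image (multipartite h) := by
    ext F
    simp only [mem_below, Finset.mem_union, mem_sideBelow, Finset.mem_image, mem_splitBelow,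
      Finset.mem_insert]
    rw [hg.mem_edgeFaces_iff hh]
    constructor
    · rintro ⟨⟨hF, hav⟩ | ⟨U, hU, rfl | rfl⟩, hlt⟩
      · refine Or.inl (Or.inl ⟨⟨hF, lt_of_le_of_ne (hlt.le.trans hg.multipartite_subset) ?_⟩, hav⟩)
        rintro rfl
        exact hT.not_avoids hav
      · refine Or.inl (Or.inr ⟨U, ⟨?_, hU⟩, rfl⟩)
        have := edgeSupport_mono hlt.le
        rw [(hg.meetsThree' hU).edgeSupport_eq, (hg.meetsThree' hT).edgeSupport_eq] at this
        refine lt_of_le_of_ne this ?_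
        rintro rfl
        exact lt_irrefl _ hlt
      · refine Or.inr ⟨U, ?_, rfl⟩
        have := edgeSupport_mono hlt.le
        rw [hU.edgeSupport_bipartition hh, (hg.meetsThree' hT).edgeSupport_eq] at this
        rcases eq_or_lt_of_le this with h1 | h1
        · exact Or.inl h1
        · exact Or.inr ⟨h1, hU⟩
    · rintro ((⟨⟨hF, hlt⟩, hav⟩ | ⟨U, ⟨hUT, hU⟩, rfl⟩) | ⟨U, hU, rfl⟩)
      · refine ⟨Or.inl ⟨hF, hav⟩, lt_of_le_of_ne (fun p hp => ?_) ?_⟩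
        · have h1 := hlt.le hp
          rw [mem_multipartite] at h1 ⊢
          refine ⟨h1.1, h1.2.1, fun h2 => ?_⟩
          exact ((hg.eq_iff _ _).1 h2).elim h1.2.2 (hav p hp)
        · rintro rfl
          exact not_avoids_of_subset hh hT hF (hg.multipartite_bipartition_subset hh) hav
      · exact ⟨Or.inr ⟨U, hU, Or.inl rfl⟩, hU.multipartite_lt' hg hUT⟩
      · have hU' : U ⊆ T ∧ IsSplit f S U := by
          rcases hU with rfl | hU
          · exact ⟨subset_rfl, hT⟩
          · exact ⟨hU.1.subset, hU.2⟩
        exact ⟨Or.inr ⟨U, hU'.2, Or.inr rfl⟩, lt_of_le_of_ne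
          ((multipartite_mono hU'.1).trans (hg.multipartite_bipartition_subset hh))
          (multipartite_ne_bipartition hg hh hT)⟩
  rw [hE, Finset.sum_union, Finset.sum_union, Finset.sum_image, Finset.sum_image,
    Finset.sum_insert hnT]
  · refine (injOn_bipartition (f := f) hh).mono fun U hU => ?_
    rcases Finset.mem_insert.1 hU with rfl | hU
    · exact hT
    · exact (mem_splitBelow.1 hU).2
  · exact (injOn_multipartite' hg).mono fun U hU => (mem_splitBelow.1 hU).2
  · rw [Finset.disjoint_left]
    intro F hF hF'
    obtain ⟨U, hU, rfl⟩ := Finset.mem_image.1 hF'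
    have h1 := mem_sideBelow.1 hF
    exact not_avoids_of_subset hh (mem_splitBelow.1 hU).2 h1.1.1
      (hg.multipartite_bipartition_subset hh) h1.2
  · rw [Finset.disjoint_left]
    intro F hF hF'
    obtain ⟨U, hU, rfl⟩ := Finset.mem_image.1 hF'
    have hU' : IsSplit f S U := by
      rcases Finset.mem_insert.1 hU with rfl | hU
      · exact hT
      · exact (mem_splitBelow.1 hU).2
    rcases Finset.mem_union.1 hF with h1 | h1
    · have h1 := mem_sideBelow.1 h1
      exact not_avoids_of_subset hh hU' h1.1.1 subset_rfl h1.2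
    · obtain ⟨W, hW, h2⟩ := Finset.mem_image.1 h1
      exact multipartite_ne_bipartition hg hh (mem_splitBelow.1 hW).2 h2.symm

/-- A proper face of the section is either an uncut face that lies in the hyperplane or the section
of a smaller cut face. -/
theorem sum_below_bipartition (hg : Merges S f g) (hh : IsBipartition S h) (hT : IsSplit f S T)
    (φ : Finset (V × V) → ABPoly) :
    ∑ F ∈ below (edgeFaces h) (multipartite h T), φ F =
      ∑ F ∈ sideBelow f S T ∩ sideBelow f Sᶜ T, φ F +
        ∑ U ∈ splitBelow f S T, φ (multipartite h U) := by
  classical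
  have hE : below (edgeFaces h) (multipartite h T) =
      (sideBelow f S T ∩ sideBelow f Sᶜ T) ∪ (splitBelow f S T).image (multipartite h) := by
    ext F
    simp only [mem_below, Finset.mem_union, Finset.mem_inter, mem_sideBelow, Finset.mem_image,
      mem_splitBelow]
    rw [hg.mem_edgeFaces_bipartition_iff hh]
    constructor
    · rintro ⟨⟨hF, h1, h2⟩ | ⟨U, hU, rfl⟩, hlt⟩
      · have hlt' : F < multipartite f T := by
          refine lt_of_le_of_ne (hlt.le.trans
            ((hg.multipartite_bipartition_subset hh).trans hg.multipartite_subset)) ?_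
          rintro rfl
          exact hT.not_avoids h1
        exact Or.inl ⟨⟨⟨hF, hlt'⟩, h1⟩, ⟨hF, hlt'⟩, h2⟩
      · refine Or.inr ⟨U, ⟨?_, hU⟩, rfl⟩
        have := edgeSupport_mono hlt.le
        rw [hU.edgeSupport_bipartition hh, hT.edgeSupport_bipartition hh] at this
        refine lt_of_le_of_ne this ?_
        rintro rfl
        exact lt_irrefl _ hlt
    · rintro (⟨⟨⟨hF, hlt⟩, h1⟩, -, h2⟩ | ⟨U, ⟨hUT, hU⟩, rfl⟩)
      · refine ⟨Or.inl ⟨hF, h1, h2⟩, lt_of_le_of_ne (fun p hp => ?_) ?_⟩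
        · have h3 := mem_multipartite.1 (hlt.le hp)
          rw [mem_multipartite_bipartition hh]
          refine ⟨h3.1, h3.2.1, fun h4 => ?_⟩
          by_cases h5 : p.1 ∈ S
          · exact h1 p hp ⟨h5, h4.1 h5⟩
          · exact h2 p hp (by simp [h5, mt h4.2 h5])
        · rintro rfl
          exact not_avoids_of_subset hh hT hF subset_rfl h1
      · exact ⟨Or.inr ⟨U, hU, rfl⟩, hU.bipartition_lt hh hUT⟩
  rw [hE, Finset.sum_union, Finset.sum_image]
  · exact (injOn_bipartition (f := f) hh).mono fun U hU => (mem_splitBelow.1 hU).2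
  · rw [Finset.disjoint_left]
    intro F hF hF'
    obtain ⟨U, hU, rfl⟩ := Finset.mem_image.1 hF'
    have h1 := mem_sideBelow.1 (Finset.mem_inter.1 hF).1
    exact not_avoids_of_subset hh (mem_splitBelow.1 hU).2 h1.1.1 subset_rfl h1.2

theorem edgeChainSum_eq (hF : F ∈ edgeFaces f) :
    chainSum (edgeFaces f) edgeRank F = (a - b) ^ (edgeRank F - 1) +
      ∑ G ∈ below (edgeFaces f) F, chainSum (edgeFaces f) edgeRank G * b *
        (a - b) ^ (edgeRank F - 1 - edgeRank G) :=
  chainSum_eq _ _ _ (fun _ h => edgeRank_pos h) (fun _ hy _ hz h => edgeRank_lt hy hz h)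
    fun _ hy h => edgeRank_lt hy hF h

open Classical in
/-- The index of the interval from `U` to `T` in the lattice of subsets. -/
def booleanSum (U T : Finset V) : ABPoly :=
  chainSum (Finset.univ.filter (U ⊂ ·)) (fun W => W.card - U.card) T

theorem booleanSum_eq (U T : Finset V) :
    booleanSum U T = (a - b) ^ (T.card - U.card - 1) +
      ∑ W ∈ Finset.univ.filter (fun W => U ⊂ W ∧ W ⊂ T), booleanSum U W * b *
        (a - b) ^ (T.card - U.card - 1 - (W.card - U.card)) := by
  classical
  have key : ∀ W W' : Finset V, U ⊂ W → W ⊂ W' → W.card - U.card < W'.card - U.card := by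
    intro W W' h1 h2
    have := Finset.card_lt_card h1
    have := Finset.card_lt_card h2
    omega
  rw [booleanSum, chainSum_eq]
  · congr 1
    refine Finset.sum_congr ?_ fun _ _ => rfl
    ext W
    simp
  · intro W hW
    have := Finset.card_lt_card (Finset.mem_filter.1 hW).2
    omega
  · intro W hW W' _ h
    exact key W W' (Finset.mem_filter.1 hW).2 h
  · intro W hW h
    exact key W T (Finset.mem_filter.1 hW).2 h

end SplitFormula

end CDIndex

namespace CDIndex

/-! ### The recursions for the two halves and the section, and the induction -/

section SplitFormula

variable {V κ : Type*} [DecidableEq V] [Fintype V]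
  {S T U : Finset V} {f f₁ f₂ g h : V → κ} {F : Finset (V × V)}

omit [DecidableEq V] [Fintype V] in
theorem IsSplit.one_lt_card (hT : IsSplit f S T) : 1 < T.card := by
  obtain ⟨⟨x, hx, y, hy, -, -, hxy⟩, -⟩ := hT
  exact Finset.one_lt_card.2 ⟨x, hx, y, hy, fun h => hxy (h ▸ rfl)⟩

theorem bipartition_mem_edgeFaces (hg : Merges S f g) (hh : IsBipartition S h)
    (hU : IsSplit f S U) : multipartite h U ∈ edgeFaces g :=
  (hg.mem_edgeFaces_iff hh).2 (Or.inr ⟨U, hU, Or.inr rfl⟩)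

/-- The recursion for the faces on one side of the hyperplane. -/
theorem edgeChainSum_side (hg : Merges S f g) (hh : IsBipartition S h) (hT : IsSplit f S T) :
    chainSum (edgeFaces g) edgeRank (multipartite g T) = (a - b) ^ (T.card - 1) +
      (∑ F ∈ sideBelow f S T, chainSum (edgeFaces f) edgeRank F * b *
          (a - b) ^ (T.card - 1 - edgeRank F) +
        ∑ U ∈ splitBelow f S T, chainSum (edgeFaces g) edgeRank (multipartite g U) * b *
          (a - b) ^ (T.card - 1 - U.card) +
        (chainSum (edgeFaces h) edgeRank (multipartite h T) * b +
          ∑ U ∈ splitBelow f S T, chainSum (edgeFaces h) edgeRank (multipartite h U) * b *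
            ((a - b) ^ (T.card - 1 - U.card) * (a - b)))) := by
  -- A section has no edge inside the complement of `S`, so the second merge leaves everything below
  -- it unchanged.
  have key : ∀ U, IsSplit f S U → chainSum (edgeFaces g) edgeRank (multipartite h U) =
      chainSum (edgeFaces h) edgeRank (multipartite h U) := fun U hU =>
    ((hg.bipartition hh).chainSum_eq hh.compl edgeRank (bipartition_mem_edgeFaces hg hh hU)
      hh.compl.avoids).symm
  rw [edgeChainSum_eq (mem_edgeFaces.2 (Or.inr ⟨T, hg.meetsThree' hT, rfl⟩)),
    sum_below_side hg hh hT, (hg.meetsThree' hT).edgeRank_eq]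
  refine congrArg₂ (· + ·) rfl (congrArg₂ (· + ·) (congrArg₂ (· + ·) ?_ ?_)
    (congrArg₂ (· + ·) ?_ ?_))
  · refine Finset.sum_congr rfl fun F hF => ?_
    have h1 := mem_sideBelow.1 hF
    rw [hg.chainSum_eq hh edgeRank h1.1.1 h1.2]
  · refine Finset.sum_congr rfl fun U hU => ?_
    rw [(hg.meetsThree' (mem_splitBelow.1 hU).2).edgeRank_eq]
  · rw [key T hT, hT.edgeRank_bipartition hh, Nat.sub_self, pow_zero, mul_one]
  · refine Finset.sum_congr rfl fun U hU => ?_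
    have h1 := mem_splitBelow.1 hU
    have h2 := Finset.card_lt_card h1.1
    have h3 := h1.2.one_lt_card
    -- The section of `U` has rank `|U| - 1`, one less than the half; this is the source of the
    -- extra factor `a - b`.
    have h4 : T.card - 1 - (U.card - 1) = T.card - 1 - U.card + 1 := by omega
    rw [key U h1.2, h1.2.edgeRank_bipartition hh, ← pow_succ, h4]

theorem edgeChainSum_split (hg : Merges S f g) (hT : IsSplit f S T) :
    chainSum (edgeFaces f) edgeRank (multipartite f T) = (a - b) ^ (T.card - 1) +
      ((∑ F ∈ sideBelow f S T, chainSum (edgeFaces f) edgeRank F * b *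
          (a - b) ^ (T.card - 1 - edgeRank F) +
        ∑ F ∈ sideBelow f Sᶜ T, chainSum (edgeFaces f) edgeRank F * b *
          (a - b) ^ (T.card - 1 - edgeRank F) -
        ∑ F ∈ sideBelow f S T ∩ sideBelow f Sᶜ T, chainSum (edgeFaces f) edgeRank F * b *
          (a - b) ^ (T.card - 1 - edgeRank F)) +
        ∑ U ∈ splitBelow f S T, chainSum (edgeFaces f) edgeRank (multipartite f U) * b *
          (a - b) ^ (T.card - 1 - U.card)) := by
  rw [edgeChainSum_eq (mem_edgeFaces.2 (Or.inr ⟨T, hg.meetsThree hT, rfl⟩)),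
    sum_below_split hg hT, (hg.meetsThree hT).edgeRank_eq]
  refine congrArg₂ (· + ·) rfl (congrArg₂ (· + ·) rfl ?_)
  refine Finset.sum_congr rfl fun U hU => ?_
  rw [(hg.meetsThree (mem_splitBelow.1 hU).2).edgeRank_eq]

/-- The recursion for the intersection with the hyperplane, multiplied by `a - b`. -/
theorem edgeChainSum_bipartition (hg : Merges S f g) (hh : IsBipartition S h)
    (hT : IsSplit f S T) :
    chainSum (edgeFaces h) edgeRank (multipartite h T) * (a - b) = (a - b) ^ (T.card - 1) +
      (∑ F ∈ sideBelow f S T ∩ sideBelow f Sᶜ T, chainSum (edgeFaces f) edgeRank F * b *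
          (a - b) ^ (T.card - 1 - edgeRank F) +
        ∑ U ∈ splitBelow f S T, chainSum (edgeFaces h) edgeRank (multipartite h U) * b *
          ((a - b) ^ (T.card - 1 - U.card) * (a - b))) := by
  have hTh : multipartite h T ∈ edgeFaces h :=
    (hg.mem_edgeFaces_bipartition_iff hh).2 (Or.inr ⟨T, hT, rfl⟩)
  have hT1 := hT.one_lt_card
  rw [edgeChainSum_eq hTh, add_mul, Finset.sum_mul, sum_below_bipartition hg hh hT,
    hT.edgeRank_bipartition hh, ← pow_succ, Nat.sub_add_cancel (by omega)]
  refine congrArg₂ (· + ·) rfl (congrArg₂ (· + ·) ?_ ?_)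
  · refine Finset.sum_congr rfl fun F hF => ?_
    have h1 := mem_sideBelow.1 (Finset.mem_inter.1 hF).1
    have h2 := mem_sideBelow.1 (Finset.mem_inter.1 hF).2
    have hFh : F ∈ edgeFaces h :=
      (hg.mem_edgeFaces_bipartition_iff hh).2 (Or.inl ⟨h1.1.1, h1.2, h2.2⟩)
    have hFg : F ∈ edgeFaces g := (hg.mem_edgeFaces_iff hh).2 (Or.inl ⟨h1.1.1, h1.2⟩)
    have hlt : F < multipartite h T := by
      refine lt_of_le_of_ne (fun p hp => ?_) ?_
      · have h3 := mem_multipartite.1 (h1.1.2.le hp)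
        rw [mem_multipartite_bipartition hh]
        refine ⟨h3.1, h3.2.1, fun h4 => ?_⟩
        by_cases h5 : p.1 ∈ S
        · exact h1.2 p hp ⟨h5, h4.1 h5⟩
        · exact h2.2 p hp (by simp [h5, mt h4.2 h5])
      · rintro rfl
        exact not_avoids_of_subset hh hT h1.1.1 subset_rfl h1.2
    have hr := edgeRank_lt hFh hTh hlt
    rw [hT.edgeRank_bipartition hh] at hr
    -- The section of `T` has rank one less than `T`. The factor `a - b` compensates, so that the
    -- terms agree with those in the recursion for `T`.
    have h5 : T.card - 1 - 1 - edgeRank F + 1 = T.card - 1 - edgeRank F := by omega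
    rw [(hg.bipartition hh).chainSum_eq hh.compl edgeRank hFg h2.2,
      hg.chainSum_eq hh edgeRank h1.1.1 h1.2, mul_assoc _ _ (a - b), ← pow_succ, h5]
  · refine Finset.sum_congr rfl fun U hU => ?_
    have h1 := mem_splitBelow.1 hU
    have h2 := Finset.card_lt_card h1.1
    have h3 := h1.2.one_lt_card
    have h4 : T.card - 1 - 1 - (U.card - 1) = T.card - 1 - U.card := by omega
    rw [h1.2.edgeRank_bipartition hh, mul_assoc _ _ (a - b), h4]

/-- The source of `d`: the term `c` comes from the inductive hypothesis for a smaller cut face and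
the term `b * (a - b)` from its section. -/
theorem c_mul_b_add : c * b + b * (a - b) = d := by
  unfold c d
  noncomm_ring

/-- The formula for a hyperplane split, for all the faces that are cut by the hyperplane. -/
theorem edgeChainSum_hyperplane_split (h₁ : Merges S f f₁) (h₂ : Merges Sᶜ f f₂)
    (hh : IsBipartition S h) (hT : IsSplit f S T) :
    chainSum (edgeFaces f₁) edgeRank (multipartite f₁ T) +
      chainSum (edgeFaces f₂) edgeRank (multipartite f₂ T) -
      chainSum (edgeFaces f) edgeRank (multipartite f T) =
    chainSum (edgeFaces h) edgeRank (multipartite h T) * c +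
      ∑ U ∈ splitBelow f S T,
        chainSum (edgeFaces h) edgeRank (multipartite h U) * d * booleanSum U T := by
  classical
  induction T using Finset.strongInduction with
  | H T ih =>
    set A : Finset V → ABPoly := fun U => chainSum (edgeFaces f) edgeRank (multipartite f U)
    set A₁ : Finset V → ABPoly := fun U => chainSum (edgeFaces f₁) edgeRank (multipartite f₁ U)
    set A₂ : Finset V → ABPoly := fun U => chainSum (edgeFaces f₂) edgeRank (multipartite f₂ U)
    set Z : Finset V → ABPoly := fun U => chainSum (edgeFaces h) edgeRank (multipartite h U)
    set e : Finset V → ABPoly := fun U => (a - b) ^ (T.card - 1 - U.card)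
    set X := ∑ F ∈ sideBelow f S T, chainSum (edgeFaces f) edgeRank F * b *
      (a - b) ^ (T.card - 1 - edgeRank F)
    set Y := ∑ F ∈ sideBelow f Sᶜ T, chainSum (edgeFaces f) edgeRank F * b *
      (a - b) ^ (T.card - 1 - edgeRank F)
    set W := ∑ F ∈ sideBelow f S T ∩ sideBelow f Sᶜ T, chainSum (edgeFaces f) edgeRank F * b *
      (a - b) ^ (T.card - 1 - edgeRank F)
    have e1 : A₁ T = (a - b) ^ (T.card - 1) + (X + ∑ U ∈ splitBelow f S T, A₁ U * b * e U +
        (Z T * b + ∑ U ∈ splitBelow f S T, Z U * b * (e U * (a - b)))) :=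
      edgeChainSum_side h₁ hh hT
    have e2 : A₂ T = (a - b) ^ (T.card - 1) + (Y + ∑ U ∈ splitBelow f S T, A₂ U * b * e U +
        (Z T * b + ∑ U ∈ splitBelow f S T, Z U * b * (e U * (a - b)))) := by
      have := edgeChainSum_side h₂ hh.compl (isSplit_compl.2 hT)
      rwa [splitBelow_compl] at this
    have e0 : A T = (a - b) ^ (T.card - 1) + (X + Y - W + ∑ U ∈ splitBelow f S T, A U * b * e U) :=
      edgeChainSum_split h₁ hT
    have ez : Z T * (a - b) = (a - b) ^ (T.card - 1) +
        (W + ∑ U ∈ splitBelow f S T, Z U * b * (e U * (a - b))) :=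
      edgeChainSum_bipartition h₁ hh hT
    -- The sections of `U` occur in both halves. One copy is used up by `ez`, the other is combined
    -- here with the inductive hypothesis.
    have ed : ∀ U ∈ splitBelow f S T, A₁ U * b * e U + A₂ U * b * e U - A U * b * e U +
        Z U * b * (e U * (a - b)) = Z U * d * e U +
          ∑ W ∈ splitBelow f S U, Z W * d * booleanSum W U * b * e U := by
      intro U hU
      have h1 := mem_splitBelow.1 hU
      have h2 : A₁ U + A₂ U - A U = Z U * c + ∑ W ∈ splitBelow f S U, Z W * d * booleanSum W U :=
        ih U h1.1 h1.2
      have h3 : e U * (a - b) = (a - b) * e U := (pow_mul_comm' _ _)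
      calc _ = (A₁ U + A₂ U - A U) * b * e U + Z U * b * (e U * (a - b)) := by noncomm_ring
        _ = Z U * (c * b + b * (a - b)) * e U +
            (∑ W ∈ splitBelow f S U, Z W * d * booleanSum W U) * b * e U := by
          rw [h2, h3]
          noncomm_ring
        _ = _ := by rw [c_mul_b_add, Finset.sum_mul, Finset.sum_mul]
    -- The recursion for the Boolean interval: its intermediate sets `U` are to be matched with the
    -- cut faces in `ed`.
    have eb : ∀ W ∈ splitBelow f S T, Z W * d * booleanSum W T = Z W * d * e W +
        ∑ U ∈ Finset.univ.filter (fun U => W ⊂ U ∧ U ⊂ T), Z W * d * booleanSum W U * b * e U := by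
      intro W hW
      have h1 := mem_splitBelow.1 hW
      have h2 := Finset.card_lt_card h1.1
      have h3 : T.card - W.card - 1 = T.card - 1 - W.card := by omega
      rw [booleanSum_eq, mul_add, Finset.mul_sum, h3]
      refine congrArg₂ (· + ·) rfl ?_
      · refine Finset.sum_congr rfl fun U hU => ?_
        rw [Finset.mem_filter] at hU
        have h3 := Finset.card_lt_card hU.2.1
        have h4 := Finset.card_lt_card hU.2.2
        have h5 : T.card - 1 - W.card - (U.card - W.card) = T.card - 1 - U.card := by omega
        rw [h5]
        noncomm_ring
    -- The exchange is possible because any set containing a split set `W` is split as well.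
    have eswap : ∑ W ∈ splitBelow f S T, ∑ U ∈ Finset.univ.filter (fun U => W ⊂ U ∧ U ⊂ T),
          Z W * d * booleanSum W U * b * e U =
        ∑ U ∈ splitBelow f S T, ∑ W ∈ splitBelow f S U, Z W * d * booleanSum W U * b * e U := by
      refine Finset.sum_comm' fun W U => ?_
      simp only [mem_splitBelow, Finset.mem_filter, Finset.mem_univ, true_and]
      constructor
      · rintro ⟨⟨h1, h2⟩, h3, h4⟩
        exact ⟨⟨h3, h2⟩, h4, h2.mono h3.subset⟩
      · rintro ⟨⟨h1, h2⟩, h3, h4⟩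
        exact ⟨⟨h1.trans h3, h2⟩, h1, h3⟩
    have etotal := Finset.sum_congr rfl ed
    rw [Finset.sum_add_distrib, Finset.sum_sub_distrib, Finset.sum_add_distrib,
      Finset.sum_add_distrib, ← eswap] at etotal
    have etotal' := Finset.sum_congr rfl eb
    rw [Finset.sum_add_distrib] at etotal'
    change A₁ T + A₂ T - A T = Z T * c + ∑ U ∈ splitBelow f S T, Z U * d * booleanSum U T
    rw [etotal', ← etotal]
    have ec : Z T * c = Z T * (a - b) + Z T * b + Z T * b := by
      unfold c
      noncomm_ring
    rw [e1, e2, e0, ec, ez]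
    abel

end SplitFormula

end CDIndex

namespace CDIndex

/-! ### The polytopes whose faces have been described -/

section Polytopes

variable {V κ : Type*} [Fintype V] [DecidableEq V]

/-- The functional with coefficients `w`. -/
def coordFunctional (w : V → ℝ) : StrongDual ℝ (V → ℝ) :=
  ∑ x, w x • ContinuousLinearMap.proj x

omit [DecidableEq V] in
theorem coordFunctional_apply (w y : V → ℝ) : coordFunctional w y = ∑ x, w x * y x := by
  simp [coordFunctional]

@[simp]
theorem coordFunctional_single (w : V → ℝ) (x : V) :
    coordFunctional w (Pi.single x 1) = w x := by
  simp [coordFunctional_apply, Pi.single_apply]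

/-- The pairs of vertices with different labels. -/
abbrev LabelPair (f : V → κ) : Type _ := {p : V × V // f p.1 ≠ f p.2}

/-- The vertex `e_x + e_y`. -/
def pairVertex (f : V → κ) (p : LabelPair f) : V → ℝ :=
  Pi.single p.1.1 1 + Pi.single p.1.2 1

/-- The convex hull of the points `e_x + e_y` for `x`, `y` with different labels. -/
def pairPolytope (f : V → κ) : Set (V → ℝ) := convexHull ℝ (Set.range (pairVertex f))

omit [Fintype V] in
theorem pairPolytope_eq (f : V → κ) :
    pairPolytope f = convexHull ℝ (Set.range (pairVertex f)) := rfl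

/-- Ordered pairs index each vertex of the polytope twice. This is harmless, since `faceEmbedding`
does not require the family of vertices to be injective. -/
theorem Psi_pairPolytope (f : V → κ) :
    Psi (pairPolytope f) = chainSum (edgeFaces f) edgeRank (multipartite f Finset.univ) := by
  classical
  let φ : FacePoset (pairPolytope f) ↪o Finset (V × V) :=
    (faceEmbedding (pairPolytope_eq f)).trans
      (Finset.mapEmbedding (Function.Embedding.subtype _))
  have htop : φ ⊤ = multipartite f Finset.univ := by
    change Finset.map _ (faceEmbedding _ ⊤) = _
    rw [faceEmbedding_top]
    ext p
    simp [mem_multipartite]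
  have hφ : IsRanked φ (edgeFaces f) ∅ edgeRank := by
    refine ⟨empty_notMem_edgeFaces, ?_, edgeRank_empty, edgeRank_strictMono,
      fun _ => exists_edgeRank_pred⟩
    ext F
    have hF : F ∈ Set.range φ ↔
        ∃ s ∈ Set.range (faceEmbedding (pairPolytope_eq f)), F = s.map
          (Function.Embedding.subtype _) :=
      ⟨fun ⟨G, hG⟩ => ⟨_, ⟨G, rfl⟩, hG.symm⟩, fun ⟨_, ⟨G, hG⟩, h⟩ => ⟨G, by rw [h, ← hG]; rfl⟩⟩
    rw [hF]
    simp only [mem_range_faceEmbedding, Set.mem_insert_iff, Finset.mem_coe]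
    constructor
    · rintro ⟨s, rfl | ⟨hs, l, hl⟩, rfl⟩
      · exact Or.inl rfl
      · refine Or.inr (mem_edgeFaces_of_maximizers (w := fun x => l (Pi.single x 1))
          (Finset.map_nonempty.2 hs) fun p => ?_)
        simp only [Finset.mem_map, Function.Embedding.subtype_apply, Subtype.exists,
          exists_and_right, exists_eq_right, hl, pairVertex, map_add, Subtype.forall,
          exists_prop]
    · rintro (rfl | hF)
      · exact ⟨∅, Or.inl rfl, rfl⟩
      · obtain ⟨hne, w, hw⟩ := exists_weight_of_mem_edgeFaces hF
        have hmem : ∀ p ∈ F, f p.1 ≠ f p.2 := fun p hp => ((hw p).1 hp).1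
        refine ⟨Finset.univ.filter fun p : LabelPair f => p.1 ∈ F, Or.inr ⟨?_,
          coordFunctional w, fun p => ?_⟩, ?_⟩
        · obtain ⟨p, hp⟩ := hne
          exact ⟨⟨p, hmem p hp⟩, by simp [hp]⟩
        · simp only [Finset.mem_filter, Finset.mem_univ, true_and, hw, pairVertex, map_add,
            coordFunctional_single, Subtype.forall]
          exact and_iff_right p.2
        · ext p
          simp only [Finset.mem_map, Finset.mem_filter, Finset.mem_univ, true_and,
            Function.Embedding.subtype_apply, Subtype.exists, exists_and_right, exists_eq_right,
            exists_prop]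
          exact ⟨fun h => ⟨hmem p h, h⟩, And.right⟩
  rw [Psi, hφ.abIndex_eq, htop]

theorem simplex_eq (p : ℕ) : simplex p = convexHull ℝ (Set.range fun i : Fin p => Pi.single i 1) :=
  (convexHull_rangle_single_eq_stdSimplex ℝ (Fin p)).symm

omit [Fintype V] [DecidableEq V] in
theorem exists_embedding_of_card {A : Finset V} {p : ℕ} (h : A.card = p) :
    ∃ γ : Fin p ↪ V, Finset.univ.map γ = A := by
  refine ⟨(A.equivFinOfCardEq h).symm.toEmbedding.trans (Function.Embedding.subtype _), ?_⟩
  ext x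
  simp only [Finset.mem_map, Finset.mem_univ, true_and]
  constructor
  · rintro ⟨i, rfl⟩
    exact ((A.equivFinOfCardEq h).symm i).2
  · intro hx
    exact ⟨A.equivFinOfCardEq h ⟨x, hx⟩, by simp⟩

/-- The index of a simplex is the index of an interval of a lattice of subsets. -/
theorem Psi_simplex {T : Finset V} {m : ℕ} (hm : (Finset.univ \ T).card = m) :
    Psi (simplex m) = booleanSum T Finset.univ := by
  classical
  obtain ⟨γ, hγ⟩ := exists_embedding_of_card hm
  have hγT : ∀ i, γ i ∉ T := fun i => by
    have : γ i ∈ Finset.univ \ T := hγ ▸ Finset.mem_map_of_mem γ (Finset.mem_univ i)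
    exact (Finset.mem_sdiff.1 this).2
  let ψ : Finset (Fin m) ↪o Finset V := OrderEmbedding.ofMapLEIff (fun s => T ∪ s.map γ) <| by
    intro s t
    constructor
    · intro h i hi
      have h1 : γ i ∈ T ∪ t.map γ :=
        h (Finset.mem_union_right _ (Finset.mem_map_of_mem γ hi))
      rcases Finset.mem_union.1 h1 with h2 | h2
      · exact absurd h2 (hγT i)
      · exact (Finset.mem_map' γ).1 h2
    · exact fun h => Finset.union_subset_union_right (Finset.map_subset_map.2 h)
  let φ : FacePoset (simplex m) ↪o Finset V := (faceEmbedding (simplex_eq m)).trans ψ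
  have htop : φ ⊤ = Finset.univ := by
    change T ∪ (faceEmbedding _ ⊤).map γ = _
    rw [faceEmbedding_top, hγ, Finset.union_sdiff_of_subset (Finset.subset_univ T)]
  have hrange : ∀ s : Finset (Fin m), s ∈ Set.range (faceEmbedding (simplex_eq m)) := by
    intro s
    rw [mem_range_faceEmbedding]
    rcases s.eq_empty_or_nonempty with h | ⟨i, hi⟩
    · exact Or.inl h
    · refine Or.inr ⟨⟨i, hi⟩, coordFunctional fun j => if j ∈ s then 1 else 0, fun j => ?_⟩
      simp only [coordFunctional_single]
      constructor
      · intro hj k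
        rw [if_pos hj]
        split_ifs <;> norm_num
      · intro h
        by_contra hj
        have := h i
        rw [if_pos hi, if_neg hj] at this
        norm_num at this
  -- The empty face corresponds to `T`, so ranks are counted from `T`. Every set of vertices of a
  -- simplex is a face.
  have hφ : IsRanked φ (Finset.univ.filter (T ⊂ ·)) T (fun W => W.card - T.card) := by
    refine ⟨by simp, ?_, Nat.sub_self _, ?_, ?_⟩
    · ext W
      simp only [Set.mem_insert_iff, Finset.coe_filter, Finset.mem_univ, true_and, Set.mem_ofPred]
      constructor
      · rintro ⟨F, rfl⟩
        have : T ⊆ φ F := Finset.subset_union_left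
        exact (eq_or_lt_of_le this).imp_left Eq.symm
      · intro hW
        have hTW : T ⊆ W := by
          rcases hW with rfl | hW
          · exact subset_rfl
          · exact hW.subset
        obtain ⟨F, hF⟩ := hrange (W.preimage γ γ.injective.injOn)
        refine ⟨F, ?_⟩
        change T ∪ (faceEmbedding _ F).map γ = W
        rw [hF]
        ext x
        simp only [Finset.mem_union, Finset.mem_map, Finset.mem_preimage]
        constructor
        · rintro (h | ⟨i, hi, rfl⟩)
          · exact hTW h
          · exact hi
        · intro hx
          by_cases hxT : x ∈ T
          · exact Or.inl hxT
          · right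
            have : x ∈ Finset.univ.map γ := by
              rw [hγ]
              simp [hxT]
            obtain ⟨i, -, rfl⟩ := Finset.mem_map.1 this
            exact ⟨i, hx, rfl⟩
    · intro W hW W' _ h
      have h1 := Finset.card_lt_card h
      have h2 : T.card ≤ W.card := by
        rcases hW with rfl | hW
        · exact le_rfl
        · exact Finset.card_le_card (Finset.mem_filter.1 hW).2.subset
      change W.card - T.card < W'.card - T.card
      omega
    · intro W hW
      have hTW := (Finset.mem_filter.1 hW).2
      obtain ⟨x, hx, hxT⟩ := Finset.exists_of_ssubset hTW
      have h1 : T ⊆ W.erase x := fun y hy =>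
        Finset.mem_erase.2 ⟨fun h => hxT (h ▸ hy), hTW.subset hy⟩
      refine ⟨W.erase x, ?_, Finset.erase_ssubset hx, ?_⟩
      · rcases eq_or_lt_of_le h1 with h2 | h2
        · exact Or.inl h2.symm
        · exact Or.inr (by simpa using h2)
      · have h2 := Finset.card_erase_of_mem hx
        have h3 := Finset.card_le_card h1
        have h4 := Finset.card_pos.2 ⟨x, hx⟩
        change (W.erase x).card - T.card + 1 = W.card - T.card
        omega
  rw [Psi, hφ.abIndex_eq, htop, booleanSum]

omit [Fintype V] in
theorem biclique_mono {A B C D : Finset V} (hA : A ⊆ C) (hB : B ⊆ D) :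
    biclique A B ⊆ biclique C D := fun p hp => by
  rw [mem_biclique] at hp ⊢
  exact hp.imp (And.imp (@hA _) (@hB _)) (And.imp (@hB _) (@hA _))

/-- The faces of a product of two simplices. -/
theorem mem_edgeFaces_subset_bipartition_iff {S T : Finset V} {h : V → κ}
    (hh : IsBipartition S h) {F : Finset (V × V)} :
    F ∈ edgeFaces h ∧ F ⊆ multipartite h T ↔
      ∃ C ⊆ T ∩ S, ∃ D ⊆ T \ S, C.Nonempty ∧ D.Nonempty ∧ F = biclique C D := by
  rw [multipartite_bipartition hh]
  have hdisj : Disjoint (T ∩ S) (T \ S) := Finset.disjoint_left.2 fun x h1 h2 =>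
    (Finset.mem_sdiff.1 h2).2 (Finset.mem_inter.1 h1).2
  constructor
  · rintro ⟨hF, hsub⟩
    rcases mem_edgeFaces.1 hF with ⟨k, A, B, hA, hB, -, -, rfl⟩ | ⟨U, hU, rfl⟩
    · rcases biclique_subset_cases hA hB hdisj hsub with ⟨h1, h2⟩ | ⟨h1, h2⟩
      · exact ⟨A, h1, B, h2, hA, hB, rfl⟩
      · exact ⟨B, h2, A, h1, hB, hA, biclique_comm⟩
    · exact absurd ((isBip_biclique hdisj).mono hsub) hU.not_isBip
  · rintro ⟨C, hC, D, hD, ⟨x, hx⟩, hD', rfl⟩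
    refine ⟨mem_edgeFaces.2 (Or.inl ⟨h x, C, D, ⟨x, hx⟩, hD', fun y hy => ?_, fun y hy => ?_,
      rfl⟩), biclique_mono hC hD⟩
    · exact (hh y x).2 (iff_of_true (Finset.mem_inter.1 (hC hy)).2 (Finset.mem_inter.1 (hC hx)).2)
    · rw [Ne, hh]
      exact fun h => (Finset.mem_sdiff.1 (hD hy)).2 (h.2 (Finset.mem_inter.1 (hC hx)).2)

theorem simplex_prod_eq (p q : ℕ) : simplex p ×ˢ simplex q = convexHull ℝ (Set.range
    fun i : Fin p × Fin q => ((Pi.single i.1 1 : Fin p → ℝ), (Pi.single i.2 1 : Fin q → ℝ))) := by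
  rw [simplex_eq, simplex_eq, ← convexHull_prod, ← Set.range_prodMap]
  rfl

/-- The maximizers of a sum of functions of two variables form a product. -/
theorem exists_eq_product_of_maximizers {ι ι' : Type*} [Fintype ι] [Fintype ι']
    {s : Finset (ι × ι')} (hs : s.Nonempty) {u : ι → ℝ} {w : ι' → ℝ}
    (h : ∀ i, i ∈ s ↔ ∀ j : ι × ι', u j.1 + w j.2 ≤ u i.1 + w i.2) :
    ∃ (C : Finset ι) (D : Finset ι'), C.Nonempty ∧ D.Nonempty ∧ s = C ×ˢ D := by
  classical
  obtain ⟨⟨i₀, j₀⟩, h₀⟩ := hs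
  have h1 := (h _).1 h₀
  simp only at h1
  have hu : ∀ i, u i ≤ u i₀ := fun i => by
    have := h1 (i, j₀)
    simp only at this
    linarith
  have hw : ∀ j, w j ≤ w j₀ := fun j => by
    have := h1 (i₀, j)
    simp only at this
    linarith
  refine ⟨Finset.univ.filter (u · = u i₀), Finset.univ.filter (w · = w j₀), ⟨i₀, by simp⟩,
    ⟨j₀, by simp⟩, ?_⟩
  ext ⟨i, j⟩
  simp only [Finset.mem_product, Finset.mem_filter, Finset.mem_univ, true_and]
  rw [h]
  constructor
  · intro h2
    have := h2 (i₀, j₀)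
    have := hu i
    have := hw j
    simp only at *
    exact ⟨by linarith, by linarith⟩
  · rintro ⟨h2, h3⟩ ⟨i', j'⟩
    have := hu i'
    have := hw j'
    simp only at *
    linarith

/-- The index of a product of simplices. -/
theorem Psi_simplex_prod {S T : Finset V} {h : V → κ} (hh : IsBipartition S h) {p q : ℕ}
    (hp : (T ∩ S).card = p) (hq : (T \ S).card = q) :
    Psi (simplex p ×ˢ simplex q) = chainSum (edgeFaces h) edgeRank (multipartite h T) := by
  classical
  obtain ⟨γ, hγ⟩ := exists_embedding_of_card hp
  obtain ⟨δ, hδ⟩ := exists_embedding_of_card hq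
  have hγδ : ∀ i j, γ i ≠ δ j := fun i j hij => by
    have h1 : γ i ∈ T ∩ S := hγ ▸ Finset.mem_map_of_mem γ (Finset.mem_univ i)
    have h2 : δ j ∈ T \ S := hδ ▸ Finset.mem_map_of_mem δ (Finset.mem_univ j)
    rw [hij] at h1
    exact (Finset.mem_sdiff.1 h2).2 (Finset.mem_inter.1 h1).2
  let σ : Finset (Fin p × Fin q) → Finset (V × V) := fun s =>
    s.image (fun i => (γ i.1, δ i.2)) ∪ s.image (fun i => (δ i.2, γ i.1))
  let ψ : Finset (Fin p × Fin q) ↪o Finset (V × V) := OrderEmbedding.ofMapLEIff σ <| by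
    intro s t
    constructor
    · rintro hst ⟨i, j⟩ hij
      have h1 : (γ i, δ j) ∈ σ t :=
        hst (Finset.mem_union_left _ (Finset.mem_image.2 ⟨(i, j), hij, rfl⟩))
      rcases Finset.mem_union.1 h1 with h2 | h2
      · obtain ⟨⟨i', j'⟩, h3, h4⟩ := Finset.mem_image.1 h2
        rw [Prod.mk.injEq] at h4
        obtain rfl := γ.injective h4.1
        obtain rfl := δ.injective h4.2
        exact h3
      · obtain ⟨⟨i', j'⟩, -, h4⟩ := Finset.mem_image.1 h2
        exact absurd (Prod.mk.inj h4).1.symm (hγδ i j')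
    · exact fun hst => Finset.union_subset_union (Finset.image_subset_image hst)
        (Finset.image_subset_image hst)
  have hσ : ∀ C D, σ (C ×ˢ D) = biclique (C.map γ) (D.map δ) := by
    intro C D
    ext ⟨x, y⟩
    simp only [σ, Finset.mem_union, Finset.mem_image, Finset.mem_product, Prod.exists,
      mem_biclique, Finset.mem_map, Prod.mk.injEq]
    constructor
    · rintro (⟨i, j, ⟨hi, hj⟩, rfl, rfl⟩ | ⟨i, j, ⟨hi, hj⟩, rfl, rfl⟩)
      · exact Or.inl ⟨⟨i, hi, rfl⟩, j, hj, rfl⟩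
      · exact Or.inr ⟨⟨j, hj, rfl⟩, i, hi, rfl⟩
    · rintro (⟨⟨i, hi, rfl⟩, j, hj, rfl⟩ | ⟨⟨j, hj, rfl⟩, i, hi, rfl⟩)
      · exact Or.inl ⟨i, j, ⟨hi, hj⟩, rfl, rfl⟩
      · exact Or.inr ⟨i, j, ⟨hi, hj⟩, rfl, rfl⟩
  let φ : FacePoset (simplex p ×ˢ simplex q) ↪o Finset (V × V) :=
    (faceEmbedding (simplex_prod_eq p q)).trans ψ
  have htop : φ ⊤ = multipartite h T := by
    change σ (faceEmbedding _ ⊤) = _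
    rw [faceEmbedding_top, ← Finset.univ_product_univ, hσ, hγ, hδ, multipartite_bipartition hh]
  have hrange : ∀ s : Finset (Fin p × Fin q), s ∈ Set.range (faceEmbedding (simplex_prod_eq p q)) ↔
      s = ∅ ∨ ∃ (C : Finset (Fin p)) (D : Finset (Fin q)), C.Nonempty ∧ D.Nonempty ∧ s = C ×ˢ D := by
    intro s
    rw [mem_range_faceEmbedding]
    refine or_congr_right ⟨?_, ?_⟩
    · rintro ⟨hs, l, hl⟩
      refine exists_eq_product_of_maximizers hs (u := fun i => l (Pi.single i 1, 0))
        (w := fun j => l (0, Pi.single j 1)) fun i => ?_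
      rw [hl]
      simp only [← map_add, Prod.mk_add_mk, add_zero, zero_add]
    · rintro ⟨C, D, ⟨i₀, hi₀⟩, ⟨j₀, hj₀⟩, rfl⟩
      refine ⟨⟨(i₀, j₀), by simp [hi₀, hj₀]⟩,
        (coordFunctional fun i => if i ∈ C then 1 else 0).comp (ContinuousLinearMap.fst ℝ _ _) +
        (coordFunctional fun j => if j ∈ D then 1 else 0).comp (ContinuousLinearMap.snd ℝ _ _),
        ?_⟩
      rintro ⟨i, j⟩
      simp only [add_apply, ContinuousLinearMap.comp_apply,
        ContinuousLinearMap.coe_fst', ContinuousLinearMap.coe_snd', coordFunctional_single,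
        Finset.mem_product]
      constructor
      · rintro ⟨hi, hj⟩ ⟨i', j'⟩
        rw [if_pos hi, if_pos hj]
        split_ifs <;> norm_num
      · intro h1
        have h2 := h1 (i₀, j₀)
        simp only [hi₀, hj₀, if_true] at h2
        by_cases hi : i ∈ C <;> by_cases hj : j ∈ D <;> simp only [hi, hj, if_true, if_false] at h2
        · exact ⟨hi, hj⟩
        all_goals norm_num at h2
  have hφ : IsRanked φ ((edgeFaces h).filter (· ⊆ multipartite h T)) ∅ edgeRank := by
    refine ⟨fun h0 => empty_notMem_edgeFaces (Finset.mem_filter.1 h0).1, ?_, edgeRank_empty,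
      fun F hF G hG hlt => edgeRank_strictMono (f := h) F
        (hF.imp_right fun h => (Finset.mem_filter.1 h).1) G
        (hG.imp_right fun h => (Finset.mem_filter.1 h).1) hlt, fun F hF => ?_⟩
    · ext F
      have hF : F ∈ Set.range φ ↔
          ∃ s ∈ Set.range (faceEmbedding (simplex_prod_eq p q)), F = σ s :=
        ⟨fun ⟨G, hG⟩ => ⟨_, ⟨G, rfl⟩, hG.symm⟩, fun ⟨_, ⟨G, hG⟩, h⟩ => ⟨G, by rw [h, ← hG]; rfl⟩⟩
      rw [hF, Set.mem_insert_iff, Finset.mem_coe, Finset.mem_filter,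
        mem_edgeFaces_subset_bipartition_iff hh]
      constructor
      · rintro ⟨s, hs, rfl⟩
        rcases (hrange s).1 hs with rfl | ⟨C, D, hC, hD, rfl⟩
        · exact Or.inl rfl
        · refine Or.inr ⟨C.map γ, ?_, D.map δ, ?_, Finset.map_nonempty.2 hC,
            Finset.map_nonempty.2 hD, hσ C D⟩
          · rw [← hγ]
            exact Finset.map_subset_map.2 (Finset.subset_univ C)
          · rw [← hδ]
            exact Finset.map_subset_map.2 (Finset.subset_univ D)
      · rintro (rfl | ⟨C, hC, D, hD, hC0, hD0, rfl⟩)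
        · exact ⟨∅, (hrange ∅).2 (Or.inl rfl), rfl⟩
        · rw [← hγ] at hC
          rw [← hδ] at hD
          obtain ⟨C', -, rfl⟩ := Finset.subset_map_iff.1 hC
          obtain ⟨D', -, rfl⟩ := Finset.subset_map_iff.1 hD
          exact ⟨C' ×ˢ D', (hrange _).2 (Or.inr ⟨C', D', Finset.map_nonempty.1 hC0,
            Finset.map_nonempty.1 hD0, rfl⟩), (hσ C' D').symm⟩
    · rw [Finset.mem_filter] at hF
      obtain ⟨G, hG, hlt, hr⟩ := exists_edgeRank_pred hF.1
      exact ⟨G, hG.imp_right fun hG => Finset.mem_filter.2 ⟨hG, hlt.le.trans hF.2⟩, hlt, hr⟩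
  rw [Psi, hφ.abIndex_eq, htop]
  -- Only faces strictly below `multipartite h T` enter the sum, so the restriction to its subsets
  -- makes no difference.
  refine chainSum_congr _ ?_
  ext F
  simp only [mem_below, Finset.mem_filter]
  exact ⟨fun hF => ⟨hF.1.1, hF.2⟩, fun hF => ⟨⟨hF.1, hF.2.le⟩, hF.2⟩⟩

end Polytopes

end CDIndex

namespace CDIndex

/-! ### The base polytope as the solution set of a system of inequalities -/

section Inequalities

variable {V κ : Type*} [Fintype V] [DecidableEq V] {f g : V → κ} {S : Finset V}

omit [Fintype V] in
theorem sum_pairVertex (p : LabelPair f) (A : Finset V) :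
    ∑ u ∈ A, pairVertex f p u = (if p.1.1 ∈ A then 1 else 0) + if p.1.2 ∈ A then 1 else 0 := by
  simp [pairVertex, Finset.sum_add_distrib, Pi.single_apply]

-- With this description, merging classes just adds the inequality of the merged class, since it
-- implies those of the classes it absorbs.
open Classical in
theorem mem_pairPolytope_iff {v₁ v₂ : V} (hne : f v₁ ≠ f v₂) {x : V → ℝ} :
    x ∈ pairPolytope f ↔ (∀ v, 0 ≤ x v) ∧ ∑ v, x v = 2 ∧
      ∀ v, ∑ u ∈ Finset.univ.filter (f · = f v), x u ≤ 1 := by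
  constructor
  · intro hx
    have hle : ∀ (l : (V → ℝ) →ₗ[ℝ] ℝ) (r : ℝ), (∀ p, l (pairVertex f p) ≤ r) → l x ≤ r :=
      fun l r h => (le_on_polytope_iff (pairPolytope_eq f) l r).2 h x hx
    have hsum : ∀ (A : Finset V) (y : V → ℝ),
        (∑ u ∈ A, LinearMap.proj (R := ℝ) (φ := fun _ => ℝ) u) y = ∑ u ∈ A, y u := by
      intro A y
      simp
    refine ⟨fun v => ?_, le_antisymm ?_ ?_, fun v => ?_⟩
    · have := hle (-LinearMap.proj v) 0 fun p => by
        simp only [LinearMap.neg_apply, LinearMap.proj_apply, pairVertex, Pi.add_apply,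
          Pi.single_apply]
        split_ifs <;> norm_num
      simpa using this
    · have := hle (∑ u, LinearMap.proj u) 2 fun p => by
        rw [hsum, sum_pairVertex]
        simp only [Finset.mem_univ, if_true]
        norm_num
      rwa [hsum] at this
    · have := hle (-∑ u, LinearMap.proj u) (-2) fun p => by
        rw [LinearMap.neg_apply, hsum, sum_pairVertex]
        simp only [Finset.mem_univ, if_true]
        norm_num
      rw [LinearMap.neg_apply, hsum] at this
      linarith
    · have := hle (∑ u ∈ Finset.univ.filter (f · = f v), LinearMap.proj u) 1 fun p => by
        rw [hsum, sum_pairVertex]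
        simp only [Finset.mem_filter, Finset.mem_univ, true_and]
        have := p.2
        split_ifs with h1 h2
        · exact absurd (h1.trans h2.symm) this
        all_goals norm_num
      rwa [hsum] at this
  · rintro ⟨hx0, hx2, hx1⟩
    by_contra hx
    obtain ⟨l, r, hl, hr⟩ := geometric_hahn_banach_closed_point (convex_convexHull ℝ _)
      ((Set.finite_range (pairVertex f)).isClosed_convexHull ℝ) hx
    set w : V → ℝ := fun v => l (Pi.single v 1)
    have hlx : l x = ∑ v, x v * w v := by
      have : x = ∑ v, x v • (Pi.single v 1 : V → ℝ) := by
        ext u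
        simp [Finset.sum_apply, Pi.single_apply]
      conv_lhs => rw [this]
      simp [w]
    obtain ⟨⟨⟨i, j⟩, hij⟩, -, hmax⟩ := Finset.exists_max_image
      (Finset.univ : Finset (LabelPair f)) (fun p => w p.1.1 + w p.1.2)
      ⟨⟨(v₁, v₂), hne⟩, Finset.mem_univ _⟩
    have hlt : ∀ i j, f i ≠ f j → w i + w j < r := fun i j hij => by
      have := hl _ (subset_convexHull ℝ _ ⟨⟨(i, j), hij⟩, rfl⟩)
      rwa [pairVertex, map_add] at this
    -- Let `X ≤ 1` be the mass of `x` on the class of `i`. Then `l x ≤ X * w i + (2 - X) * w j ≤ w i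
    -- + w j < r`, against the separation.
    have key : ∀ i j, f i ≠ f j → w j ≤ w i →
        (∀ q : V × V, f q.1 ≠ f q.2 → w q.1 + w q.2 ≤ w i + w j) → False := by
      intro i j hij hw hmax
      obtain ⟨⟨h1, h2⟩, -⟩ := weight_cases hij hmax
      have h3 := Finset.sum_filter_add_sum_filter_not Finset.univ (f · = f i) x
      have h4 := Finset.sum_filter_add_sum_filter_not Finset.univ (f · = f i) fun v => x v * w v
      have h5 : ∑ v ∈ Finset.univ.filter (f · = f i), x v * w v ≤
          (∑ v ∈ Finset.univ.filter (f · = f i), x v) * w i := by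
        rw [Finset.sum_mul]
        exact Finset.sum_le_sum fun v hv =>
          mul_le_mul_of_nonneg_left (h1 v (Finset.mem_filter.1 hv).2) (hx0 v)
      have h6 : ∑ v ∈ Finset.univ.filter (¬ f · = f i), x v * w v ≤
          (∑ v ∈ Finset.univ.filter (¬ f · = f i), x v) * w j := by
        rw [Finset.sum_mul]
        exact Finset.sum_le_sum fun v hv =>
          mul_le_mul_of_nonneg_left (h2 v (Finset.mem_filter.1 hv).2) (hx0 v)
      have h7 := hx1 i
      have h8 := hlt i j hij
      set X := ∑ v ∈ Finset.univ.filter (f · = f i), x v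
      have h9 : ∑ v ∈ Finset.univ.filter (¬ f · = f i), x v = 2 - X := by linarith
      rw [h9] at h6
      nlinarith [mul_nonneg (sub_nonneg.2 h7) (sub_nonneg.2 hw)]
    rcases le_total (w j) (w i) with h | h
    · exact key i j hij h fun q hq => hmax ⟨q, hq⟩ (Finset.mem_univ _)
    · refine key j i hij.symm h fun q hq => ?_
      rw [add_comm (w j)]
      exact hmax ⟨q, hq⟩ (Finset.mem_univ _)

/-- Merging the classes in `S` cuts the polytope with a half-space. -/
theorem Merges.pairPolytope_eq (hg : Merges S f g) {s v₁ v₂ : V} (hs : s ∈ S)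
    (hne : g v₁ ≠ g v₂) :
    pairPolytope g = pairPolytope f ∩ {x | ∑ v ∈ S, x v ≤ 1} := by
  classical
  have hne' : f v₁ ≠ f v₂ := fun h => hne ((hg.eq_iff _ _).2 (Or.inl h))
  have hS : Finset.univ.filter (g · = g s) = S := by
    ext u
    simp only [Finset.mem_filter, Finset.mem_univ, true_and, hg.eq_iff]
    exact ⟨fun h => h.elim (fun h => hg.compat s u h.symm hs) And.left, fun h => Or.inr ⟨h, hs⟩⟩
  ext x
  rw [Set.mem_inter_iff, mem_pairPolytope_iff hne, mem_pairPolytope_iff hne', Set.mem_ofPred]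
  constructor
  · rintro ⟨h0, h2, h1⟩
    refine ⟨⟨h0, h2, fun v => le_trans (Finset.sum_le_sum_of_subset_of_nonneg ?_ fun u _ _ => h0 u)
      (h1 v)⟩, ?_⟩
    · intro u hu
      simp only [Finset.mem_filter, Finset.mem_univ, true_and, hg.eq_iff] at hu ⊢
      exact Or.inl hu
    · have := h1 s
      rwa [hS] at this
  · rintro ⟨⟨h0, h2, h1⟩, hx⟩
    refine ⟨h0, h2, fun v => ?_⟩
    by_cases hv : v ∈ S
    · rwa [(hg.eq_iff v s).2 (Or.inr ⟨hv, hs⟩), hS]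
    · have : Finset.univ.filter (g · = g v) = Finset.univ.filter (f · = f v) := by
        ext u
        simp only [Finset.mem_filter, Finset.mem_univ, true_and, hg.eq_iff]
        exact or_iff_left fun h => hv h.2
      rw [this]
      exact h1 v

omit [Fintype V] [DecidableEq V] in
theorem isExposed_inter_hyperplane {Q : Set (V → ℝ)} (l : StrongDual ℝ (V → ℝ)) {t : ℝ}
    (h : ∀ x ∈ Q, l x ≤ t) : IsExposed ℝ Q (Q ∩ {x | l x = t}) := by
  rintro ⟨y, hy, hyt⟩
  have hyt : l y = t := hyt
  refine ⟨l, Set.ext fun x => and_congr_right fun hx => ⟨fun hxt z hz => ?_, fun hxt => ?_⟩⟩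
  · have hxt : l x = t := hxt
    rw [hxt]
    exact h z hz
  · exact le_antisymm (h x hx) (hyt ▸ hxt y hy)

end Inequalities

/-! ### Loopless matroids of rank two -/

section Labels

variable {α κ : Type*} {M : Matroid α} {f : α → κ}

/-- `M` is loopless, and two of its elements are parallel if and only if they have the same
label. -/
structure IsLabelledBy (M : Matroid α) (f : α → κ) : Prop where
  isNonloop : ∀ e ∈ M.E, M.IsNonloop e
  indep_pair : ∀ e ∈ M.E, ∀ g ∈ M.E, e ≠ g → (M.Indep {e, g} ↔ f e ≠ f g)

theorem parallel_iff_closure_eq {e g : α} (he : M.IsNonloop e) (hg : M.IsNonloop g) :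
    Parallel M e g ↔ M.closure {e} = M.closure {g} := by
  by_cases h : e = g
  · subst h
    simp [Parallel, he]
  · rw [he.closure_eq_closure_iff_isCircuit_of_ne h, Parallel]
    simp [he, hg, h]

theorem parallel_iff_eq_or_not_indep {e g : α} (he : M.IsNonloop e) (hg : M.IsNonloop g) :
    Parallel M e g ↔ e = g ∨ ¬ M.Indep {e, g} := by
  rw [parallel_iff_closure_eq he hg, he.closure_eq_closure_iff_eq_or_dep hg]

namespace IsLabelledBy

theorem parallel_iff (h : IsLabelledBy M f) {e g : α} :
    Parallel M e g ↔ e ∈ M.E ∧ g ∈ M.E ∧ f e = f g := by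
  constructor
  · intro hp
    have he := hp.1.mem_ground
    have hg := hp.2.1.mem_ground
    refine ⟨he, hg, ?_⟩
    rcases (parallel_iff_eq_or_not_indep hp.1 hp.2.1).1 hp with rfl | hp
    · rfl
    · by_cases heg : e = g
      · rw [heg]
      · rwa [h.indep_pair e he g hg heg, not_not] at hp
  · rintro ⟨he, hg, hf⟩
    rw [parallel_iff_eq_or_not_indep (h.isNonloop e he) (h.isNonloop g hg)]
    by_cases heg : e = g
    · exact Or.inl heg
    · exact Or.inr fun hi => (h.indep_pair e he g hg heg).1 hi hf

theorem parallelClasses_eq (h : IsLabelledBy M f) :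
    parallelClasses M = {C | ∃ e ∈ M.E, C = {g | g ∈ M.E ∧ f g = f e}} := by
  ext C
  refine ⟨?_, ?_⟩
  · rintro ⟨e, he, rfl⟩
    refine ⟨e, he.mem_ground, Set.ext fun g => ?_⟩
    change Parallel M e g ↔ _
    rw [h.parallel_iff, and_iff_right he.mem_ground]
    exact and_congr_right fun _ => eq_comm
  · rintro ⟨e, he, rfl⟩
    refine ⟨e, h.isNonloop e he, Set.ext fun g => ?_⟩
    change _ ↔ Parallel M e g
    rw [h.parallel_iff, and_iff_right he]
    exact and_congr_right fun _ => eq_comm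

theorem restrict (h : IsLabelledBy M f) {T : Set α} (hT : T ⊆ M.E) :
    IsLabelledBy (M.restrict T) f := by
  refine ⟨fun e he => Matroid.restrict_isNonloop_iff.2 ⟨h.isNonloop e (hT he), he⟩,
    fun e he g hg heg => ?_⟩
  rw [Matroid.restrict_indep_iff, h.indep_pair e (hT he) g (hT hg) heg]
  exact and_iff_left (Set.pair_subset he hg)

theorem isBase_iff (h : IsLabelledBy M f) (hr : M.eRank = 2) {B : Set α} :
    M.IsBase B ↔ ∃ x ∈ M.E, ∃ y ∈ M.E, f x ≠ f y ∧ B = {x, y} := by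
  constructor
  · intro hB
    have h2 := hB.encard_eq_eRank
    rw [hr, Set.encard_eq_two] at h2
    obtain ⟨x, y, hxy, rfl⟩ := h2
    have hx := hB.subset_ground (Set.mem_insert x _)
    have hy := hB.subset_ground (Set.mem_insert_of_mem x rfl)
    exact ⟨x, hx, y, hy, (h.indep_pair x hx y hy hxy).1 hB.indep, rfl⟩
  · rintro ⟨x, hx, y, hy, hxy, rfl⟩
    have hne : x ≠ y := fun h => hxy (h ▸ rfl)
    obtain ⟨B, hB, hsub⟩ := ((h.indep_pair x hx y hy hne).2 hxy).exists_isBase_superset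
    have hB2 := hB.encard_eq_eRank
    rw [hr] at hB2
    have hfin : B.Finite := Set.finite_of_encard_eq_coe (k := 2) hB2
    have hle : B.encard ≤ ({x, y} : Set α).encard := by rw [hB2, Set.encard_pair hne]
    rwa [hfin.eq_of_subset_of_encard_le' hsub hle]

end IsLabelledBy

/-- The loopless matroid of rank two with prescribed parallelism classes. -/
theorem exists_isLabelledBy [Finite α] (f : α → κ) {x y : α} (hxy : f x ≠ f y) :
    ∃ M : Matroid α, M.E = Set.univ ∧ M.eRank = 2 ∧ IsLabelledBy M f := by
  let I : IndepMatroid α := IndepMatroid.ofFinite (E := Set.univ) Set.finite_univ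
    (fun I => I.ncard ≤ 2 ∧ Set.InjOn f I) (by simp)
    (fun I J hJ hIJ => ⟨(Set.ncard_le_ncard hIJ J.toFinite).trans hJ.1, hJ.2.mono hIJ⟩)
    (by
      intro I J hI hJ hlt
      rcases Nat.lt_or_ge I.ncard 1 with h0 | h1
      · have hI0 : I = ∅ := by
          rw [← Set.ncard_eq_zero I.toFinite]
          omega
        have hJ0 : J.Nonempty := by
          rw [← Set.ncard_pos J.toFinite]
          omega
        obtain ⟨e, he⟩ := hJ0
        subst hI0
        refine ⟨e, he, Set.notMem_empty e, ?_, ?_⟩ <;> simp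
      · have hI1 : I.ncard = 1 := by
          have := hJ.1
          omega
        obtain ⟨z, rfl⟩ := Set.ncard_eq_one.1 hI1
        -- Augmentation: `J` contains two elements with different labels, and at most one of them
        -- shares the label of `z`.
        obtain ⟨u, hu, v, hv, huv⟩ :=
          (Set.one_lt_ncard_iff_nontrivial (s := J)).1 (by omega)
        have key : ∀ e ∈ J, f e ≠ f z → ∃ e ∈ J, e ∉ ({z} : Set α) ∧
            (insert e ({z} : Set α)).ncard ≤ 2 ∧ Set.InjOn f (insert e {z}) := by
          intro e he hez
          have hne : e ∉ ({z} : Set α) := fun h => hez (congrArg f h)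
          refine ⟨e, he, hne, ?_, ?_⟩
          · rw [Set.ncard_insert_of_notMem hne, Set.ncard_singleton]
          · rw [Set.injOn_insert hne]
            simpa using hez
        by_cases h : f u = f z
        · refine key v hv fun h' => huv (hJ.2 hu hv (h.trans h'.symm))
        · exact key u hu h)
    (fun I _ => Set.subset_univ I)
  have hI : ∀ X, I.matroid.Indep X ↔ X.ncard ≤ 2 ∧ Set.InjOn f X := fun X => Iff.rfl
  have hpair : ∀ e g : α, e ≠ g → (I.matroid.Indep {e, g} ↔ f e ≠ f g) := by
    intro e g heg
    rw [hI, Set.ncard_pair heg, Set.injOn_pair]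
    simp only [le_refl, true_and]
    exact ⟨fun h h' => heg (h h'), fun h h' => absurd h' h⟩
  refine ⟨I.matroid, rfl, ?_, ?_, fun e _ g _ heg => hpair e g heg⟩
  · have hne : x ≠ y := fun h => hxy (h ▸ rfl)
    obtain ⟨B, hB, hsub⟩ := ((hpair x y hne).2 hxy).exists_isBase_superset
    rw [← hB.encard_eq_eRank]
    have h1 := ((hI B).1 hB.indep).1
    have h2 := Set.ncard_le_ncard hsub B.toFinite
    rw [Set.ncard_pair hne] at h2
    rw [← B.toFinite.cast_ncard_eq, le_antisymm h1 h2]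
    rfl
  · intro e _
    rw [← Matroid.indep_singleton, hI]
    simp

variable {n : ℕ} {M : Matroid (Fin n)} {f : Fin n → κ}

theorem IsLabelledBy.basePolytope_eq (h : IsLabelledBy M f) (hE : M.E = Set.univ)
    (hr : M.eRank = 2) : basePolytope M = pairPolytope f := by
  have hind : ∀ x y : Fin n, x ≠ y →
      (({x, y} : Set (Fin n)).indicator 1 : Fin n → ℝ) = Pi.single x 1 + Pi.single y 1 := by
    intro x y hxy
    ext z
    by_cases hx : z = x
    · subst hx
      simp [hxy]
    · by_cases hy : z = y
      · subst hy
        simp [hx]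
      · simp [hx, hy]
  unfold basePolytope pairPolytope
  congr 1
  ext v
  simp only [Set.mem_ofPred, h.isBase_iff hr, hE, Set.mem_univ, true_and, Set.mem_range]
  constructor
  · rintro ⟨_, ⟨x, y, hxy, rfl⟩, rfl⟩
    exact ⟨⟨(x, y), hxy⟩, (hind x y fun h => hxy (h ▸ rfl)).symm⟩
  · rintro ⟨⟨⟨x, y⟩, hxy⟩, rfl⟩
    exact ⟨_, ⟨x, y, hxy, rfl⟩, (hind x y fun h => hxy (h ▸ rfl)).symm⟩

end Labels

end CDIndex

namespace CDIndex

/-! ### From labellings to the split of base polytopes -/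

section HyperplaneSplit

variable {κ : Type*} {n : ℕ} {M M₁ M₂ : Matroid (Fin n)} {f f₁ f₂ h : Fin n → κ}
  {S : Finset (Fin n)}

theorem merges_ite {V : Type*} [DecidableEq V] {f : V → κ} {S : Finset V} {s : V} (hs : s ∈ S)
    (hf : ∀ x y, f x = f y → x ∈ S → y ∈ S) :
    Merges S f fun x => if x ∈ S then f s else f x := by
  refine ⟨hf, fun x y => ?_⟩
  by_cases hx : x ∈ S <;> by_cases hy : y ∈ S <;> simp only [hx, hy, if_true, if_false]
  · simp
  · refine ⟨fun h => absurd (hf s y h hs) hy, fun h => ?_⟩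
    exact absurd (hf x y (h.resolve_right (by simp)) hx) hy
  · refine ⟨fun h => absurd (hf s x h.symm hs) hx, fun h => ?_⟩
    exact absurd (hf y x (h.resolve_right (by simp)).symm hy) hx
  · simp

theorem isBipartition_ite {V : Type*} [DecidableEq V] {f : V → κ} {S : Finset V} {s t : V}
    (hst : f s ≠ f t) : IsBipartition S fun x => if x ∈ S then f s else f t := by
  intro x y
  by_cases hx : x ∈ S <;> by_cases hy : y ∈ S <;> simp [hx, hy, hst, hst.symm]

theorem IsLabelledBy.splitSubsets_eq (hM : IsLabelledBy M f) (hE : M.E = Set.univ)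
    (hf : ∀ x y, f x = f y → (x ∈ S ↔ y ∈ S)) :
    splitSubsets M S = splitBelow f S Finset.univ := by
  have key : ∀ (T : Finset (Fin n)) (A : Set (Fin n)), (∀ x y, f x = f y → x ∈ A → y ∈ A) →
      (2 ≤ {C ∈ parallelClasses (M.restrict (T : Set (Fin n))) | C ⊆ A}.ncard ↔
        ∃ x ∈ T, ∃ y ∈ T, x ∈ A ∧ y ∈ A ∧ f x ≠ f y) := by
    intro T A hA
    have hT := hM.restrict (T := (T : Set (Fin n))) (by rw [hE]; exact Set.subset_univ _)
    rw [hT.parallelClasses_eq, Matroid.restrict_ground_eq]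
    rw [show (2 ≤ Set.ncard _ ↔ 1 < Set.ncard _) from Iff.rfl,
      Set.one_lt_ncard_iff (Set.toFinite _)]
    constructor
    · rintro ⟨_, _, ⟨⟨x, hx, rfl⟩, hxA⟩, ⟨⟨y, hy, rfl⟩, hyA⟩, hne⟩
      refine ⟨x, hx, y, hy, hxA ⟨hx, rfl⟩, hyA ⟨hy, rfl⟩, fun h => hne ?_⟩
      rw [h]
    · rintro ⟨x, hx, y, hy, hxA, hyA, hxy⟩
      refine ⟨_, _, ⟨⟨x, hx, rfl⟩, fun z hz => hA x z hz.2.symm hxA⟩,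
        ⟨⟨y, hy, rfl⟩, fun z hz => hA y z hz.2.symm hyA⟩, fun h => hxy ?_⟩
      have : x ∈ {g | g ∈ (T : Set (Fin n)) ∧ f g = f y} := h ▸ ⟨hx, rfl⟩
      exact this.2
  ext T
  rw [splitSubsets, Finset.mem_filter, mem_splitBelow, Finset.ssubset_univ_iff, IsSplit,
    key T S fun x y h => (hf x y h).1, key T (S : Set (Fin n))ᶜ fun x y h => mt (hf x y h).2]
  simp only [Finset.mem_univ, true_and, Finset.mem_coe, Set.mem_compl_iff]
  -- The condition on four classes follows from the other two: classes are nonempty, so none lies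
  -- both in `S` and in its complement.
  refine and_congr_right fun _ => and_iff_right_of_imp fun ⟨h1, h2⟩ => ?_
  have h1' := (key T S fun x y h => (hf x y h).1).2 h1
  have h2' := (key T (S : Set (Fin n))ᶜ fun x y h => mt (hf x y h).2).2 h2
  refine le_trans (Nat.add_le_add h1' h2') ?_
  rw [← Set.ncard_union_eq]
  · exact Set.ncard_le_ncard (Set.union_subset (Set.sep_subset _ _) (Set.sep_subset _ _))
      (Set.toFinite _)
  · rw [Set.disjoint_left]
    rintro C ⟨⟨e, he, rfl⟩, hCS⟩ ⟨-, hCS'⟩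
    have : e ∈ {g | Parallel (M.restrict (T : Set (Fin n))) e g} := ⟨he, he, Or.inl rfl⟩
    exact hCS' this (hCS this)

theorem isHyperplaneSplit (hM : IsLabelledBy M f) (hE : M.E = Set.univ) (hr : M.eRank = 2)
    (hM₁ : IsLabelledBy M₁ f₁) (hE₁ : M₁.E = Set.univ) (hr₁ : M₁.eRank = 2)
    (hM₂ : IsLabelledBy M₂ f₂) (hE₂ : M₂.E = Set.univ) (hr₂ : M₂.eRank = 2)
    (h₁ : Merges S f f₁) (h₂ : Merges Sᶜ f f₂) (hS : IsSplit f S Finset.univ) :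
    IsHyperplaneSplit M M₁ M₂ S 1 := by
  obtain ⟨⟨s, -, s', -, hs, hs', hss⟩, t, -, t', -, ht, ht', htt⟩ := hS
  have hQ := hM.basePolytope_eq hE hr
  have hQ₁ := hM₁.basePolytope_eq hE₁ hr₁
  have hQ₂ := hM₂.basePolytope_eq hE₂ hr₂
  have hf₁ : f₁ t ≠ f₁ t' := h₁.ne_of_notMem ht htt
  have hf₂ : f₂ s ≠ f₂ s' := h₂.ne_of_notMem (by simpa using hs) hss
  have left : basePolytope M₁ = basePolytope M ∩ {x | ∑ e ∈ S, x e ≤ 1} := by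
    rw [hQ, hQ₁]
    exact h₁.pairPolytope_eq hs hf₁
  have right : basePolytope M₂ = basePolytope M ∩ {x | 1 ≤ ∑ e ∈ S, x e} := by
    rw [hQ, hQ₂, h₂.pairPolytope_eq (Finset.mem_compl.2 ht) hf₂]
    ext x
    simp only [Set.mem_inter_iff, Set.mem_ofPred]
    refine and_congr_right fun hx => ?_
    -- The coordinates sum to 2, so a sum of at most 1 over the complement is a sum of at least 1
    -- over `S`.
    have h2 := ((mem_pairPolytope_iff hss).1 hx).2.1
    have h3 := Finset.sum_add_sum_compl S x
    constructor <;> intro h <;> linarith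
  have inter : basePolytope M₁ ∩ basePolytope M₂ = basePolytope M ∩ {x | ∑ e ∈ S, x e = 1} := by
    rw [left, right]
    ext x
    simp only [Set.mem_inter_iff, Set.mem_ofPred]
    constructor
    · rintro ⟨⟨h1, h2⟩, -, h3⟩
      exact ⟨h1, le_antisymm h2 h3⟩
    · rintro ⟨h1, h2⟩
      exact ⟨⟨h1, h2.le⟩, h1, h2.ge⟩
  have hsum : ∀ x : Fin n → ℝ,
      coordFunctional (fun e => if e ∈ S then 1 else 0) x = ∑ e ∈ S, x e := by
    intro x
    simp [coordFunctional_apply]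
  refine ⟨hE₁, hE₂, ?_, ⟨?_, ?_⟩, ⟨?_, ?_⟩, left, right, inter⟩
  · rw [left, right, ← Set.inter_union_distrib_left]
    refine (Set.inter_eq_left.2 fun x _ => ?_).symm
    exact le_total (∑ e ∈ S, x e) 1
  · have : basePolytope M₁ ∩ basePolytope M₂ = basePolytope M₁ ∩
        {x | coordFunctional (fun e => if e ∈ S then 1 else 0) x = 1} := by
      rw [inter, left]
      ext x
      simp only [Set.mem_inter_iff, Set.mem_ofPred, hsum]
      exact ⟨fun h => ⟨⟨h.1, h.2.le⟩, h.2⟩, fun h => ⟨h.1.1, h.2⟩⟩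
    rw [this]
    refine isExposed_inter_hyperplane _ fun x hx => ?_
    rw [hsum]
    rw [left] at hx
    exact hx.2
  · intro heq
    -- Both `t` and `t'` are outside `S`, so this vertex has coordinate sum 0 over `S` and is off
    -- the hyperplane. For `M₂`, the vertex of `s` and `s'` has sum 2.
    have hv : pairVertex f₁ ⟨(t, t'), hf₁⟩ ∈ basePolytope M₁ :=
      hQ₁ ▸ subset_convexHull ℝ _ ⟨_, rfl⟩
    rw [← heq, inter] at hv
    have := hv.2
    rw [Set.mem_ofPred, sum_pairVertex] at this
    simp [ht, ht'] at this
  · have : basePolytope M₁ ∩ basePolytope M₂ = basePolytope M₂ ∩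
        {x | (-coordFunctional (fun e => if e ∈ S then 1 else 0)) x = -1} := by
      rw [inter, right]
      ext x
      simp only [Set.mem_inter_iff, Set.mem_ofPred, neg_apply, hsum, neg_inj]
      exact ⟨fun h => ⟨⟨h.1, h.2.ge⟩, h.2⟩, fun h => ⟨h.1.1, h.2⟩⟩
    rw [this]
    refine isExposed_inter_hyperplane _ fun x hx => ?_
    rw [right] at hx
    rw [neg_apply, hsum]
    exact neg_le_neg hx.2
  · intro heq
    have hv : pairVertex f₂ ⟨(s, s'), hf₂⟩ ∈ basePolytope M₂ :=
      hQ₂ ▸ subset_convexHull ℝ _ ⟨_, rfl⟩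
    rw [← heq, inter] at hv
    have := hv.2
    rw [Set.mem_ofPred, sum_pairVertex] at this
    simp [hs, hs'] at this

theorem Psi_pairPolytope_split (h₁ : Merges S f f₁) (h₂ : Merges Sᶜ f f₂)
    (hh : IsBipartition S h) (hS : IsSplit f S Finset.univ) :
    Psi (pairPolytope f) = Psi (pairPolytope f₁) + Psi (pairPolytope f₂)
      - Psi (simplex S.card ×ˢ simplex (n - S.card)) * c
      - ∑ T ∈ splitBelow f S Finset.univ,
          Psi (simplex (T ∩ S).card ×ˢ simplex (T \ S).card) * d * Psi (simplex (n - T.card)) := by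
  have hsub : ∀ T : Finset (Fin n), (Finset.univ \ T).card = n - T.card := fun T => by
    rw [Finset.card_sdiff_of_subset (Finset.subset_univ T), Finset.card_univ, Fintype.card_fin]
  rw [Psi_pairPolytope, Psi_pairPolytope, Psi_pairPolytope,
    Psi_simplex_prod hh (T := Finset.univ) (by rw [Finset.univ_inter]) (hsub S),
    Finset.sum_congr rfl fun T _ => by
      rw [Psi_simplex_prod hh rfl rfl, Psi_simplex (hsub T)]]
  have := edgeChainSum_hyperplane_split h₁ h₂ hh hS
  rw [sub_sub, ← this]
  abel

end HyperplaneSplit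

end CDIndex

end

/-! ### The theorem for the classes of a matroid -/

theorem mainTheorem6 {n k m : ℕ} (M : Matroid (Fin n)) (hE : M.E = Set.univ)
    (hloop : M.Loopless) (hrank : M.eRank = 2)
    (P : Fin k → Finset (Fin n)) (hPinj : Function.Injective P)
    (hP : CDIndex.parallelClasses M = Set.range fun i => (P i : Set (Fin n)))
    (hk : 4 ≤ k) (hm : 2 ≤ m) (hmk : m + 2 ≤ k)
    (S : Finset (Fin n)) (hS : S = (Finset.univ.filter fun i : Fin k => i.val < m).biUnion P) :
    ∃ M₁ M₂ : Matroid (Fin n),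
      (M₁.E = Set.univ ∧ M₁.Loopless ∧ M₁.eRank = 2 ∧
        CDIndex.parallelClasses M₁ =
          insert (S : Set (Fin n)) ((fun i => (P i : Set (Fin n))) '' {i | m ≤ i.val})) ∧
      (M₂.E = Set.univ ∧ M₂.Loopless ∧ M₂.eRank = 2 ∧
        CDIndex.parallelClasses M₂ =
          insert (S : Set (Fin n))ᶜ ((fun i => (P i : Set (Fin n))) '' {i | i.val < m})) ∧
      CDIndex.IsHyperplaneSplit M M₁ M₂ S 1 ∧
      CDIndex.Psi (CDIndex.basePolytope M) =
        CDIndex.Psi (CDIndex.basePolytope M₁) + CDIndex.Psi (CDIndex.basePolytope M₂)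
          - CDIndex.Psi (CDIndex.simplex S.card ×ˢ CDIndex.simplex (n - S.card)) * CDIndex.c
          - ∑ T ∈ CDIndex.splitSubsets M S,
              CDIndex.Psi (CDIndex.simplex (T ∩ S).card ×ˢ CDIndex.simplex (T \ S).card)
                * CDIndex.d * CDIndex.Psi (CDIndex.simplex (n - T.card)) := by
  have hnl : ∀ e, M.IsNonloop e := fun e =>
    Matroid.loopless_iff_forall_isNonloop.1 hloop e (hE ▸ Set.mem_univ e)
  have hpar : ∀ e g, CDIndex.Parallel M e g ↔ M.closure {e} = M.closure {g} := fun e g =>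
    CDIndex.parallel_iff_closure_eq (hnl e) (hnl g)
  have hcover : ∀ e, ∃ i, ∀ g, g ∈ P i ↔ M.closure {e} = M.closure {g} := by
    intro e
    have h1 : {g | CDIndex.Parallel M e g} ∈ CDIndex.parallelClasses M := ⟨e, hnl e, rfl⟩
    rw [hP] at h1
    obtain ⟨i, hi⟩ := h1
    refine ⟨i, fun g => ?_⟩
    have := Set.ext_iff.1 hi g
    rwa [Finset.mem_coe, Set.mem_ofPred, hpar] at this
  -- The label of an element is the index of its parallelism class.
  choose f hf using hcover
  have hfP : ∀ i e, e ∈ P i ↔ f e = i := by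
    intro i e
    have h1 : (P i : Set (Fin n)) ∈ CDIndex.parallelClasses M := hP ▸ ⟨i, rfl⟩
    obtain ⟨e', -, he'⟩ := h1
    have h2 : ∀ g, g ∈ P i ↔ M.closure {e'} = M.closure {g} := fun g => by
      have := Set.ext_iff.1 he' g
      rwa [Finset.mem_coe, Set.mem_ofPred, hpar] at this
    refine ⟨fun h => hPinj ?_, fun h => h ▸ (hf e e).2 rfl⟩
    ext g
    rw [hf, h2, (h2 e).1 h]
  have hsurj : ∀ i, ∃ e, f e = i := by
    intro i
    have h1 : (P i : Set (Fin n)) ∈ CDIndex.parallelClasses M := hP ▸ ⟨i, rfl⟩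
    obtain ⟨e, he, he'⟩ := h1
    have h2 : e ∈ (P i : Set (Fin n)) := he' ▸ (hpar e e).2 rfl
    exact ⟨e, (hfP i e).1 h2⟩
  have hmemS : ∀ e, e ∈ S ↔ (f e).val < m := by
    intro e
    simp only [hS, Finset.mem_biUnion, Finset.mem_filter, Finset.mem_univ, true_and, hfP]
    exact ⟨fun ⟨i, hi, h⟩ => h ▸ hi, fun h => ⟨_, h, rfl⟩⟩
  have hM : CDIndex.IsLabelledBy M f := by
    refine ⟨fun e _ => hnl e, fun e _ g _ heg => ?_⟩
    have h1 := CDIndex.parallel_iff_eq_or_not_indep (hnl e) (hnl g)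
    rw [hpar, ← hf, hfP, or_iff_right heg] at h1
    rw [Ne, eq_comm, h1, not_not]
  -- Classes 0 and 1 lie in `S` because `2 ≤ m`; classes `m` and `m + 1` exist, outside `S`, because
  -- `m + 2 ≤ k`. They witness that the whole ground set is split.
  obtain ⟨s, hs⟩ := hsurj ⟨0, by omega⟩
  obtain ⟨s', hs'⟩ := hsurj ⟨1, by omega⟩
  obtain ⟨t, ht⟩ := hsurj ⟨m, by omega⟩
  obtain ⟨t', ht'⟩ := hsurj ⟨m + 1, by omega⟩
  have hsS : s ∈ S := by
    rw [hmemS, hs]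
    change 0 < m
    omega
  have hs'S : s' ∈ S := by
    rw [hmemS, hs']
    exact hm
  have htS : t ∉ S := by
    rw [hmemS, ht]
    exact lt_irrefl m
  have ht'S : t' ∉ S := by
    rw [hmemS, ht']
    exact Nat.not_lt.2 (Nat.le_succ m)
  have hss : f s ≠ f s' := by
    rw [hs, hs']
    simp
  have htt : f t ≠ f t' := by
    rw [ht, ht']
    simp
  have hst : f s ≠ f t := by
    rw [hs, ht]
    simp only [ne_eq, Fin.mk.injEq]
    omega
  have hsplit : CDIndex.IsSplit f S Finset.univ :=
    ⟨⟨s, Finset.mem_univ _, s', Finset.mem_univ _, hsS, hs'S, hss⟩,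
      t, Finset.mem_univ _, t', Finset.mem_univ _, htS, ht'S, htt⟩
  have hcompat : ∀ x y, f x = f y → (x ∈ S ↔ y ∈ S) := fun x y h => by
    rw [hmemS, hmemS, h]
  have h₁ := CDIndex.merges_ite hsS fun x y h => (hcompat x y h).1
  have h₂ := CDIndex.merges_ite (S := Sᶜ) (Finset.mem_compl.2 htS) fun x y h hx =>
    Finset.mem_compl.2 (mt (hcompat x y h).2 (Finset.mem_compl.1 hx))
  have hh : CDIndex.IsBipartition S _ := CDIndex.isBipartition_ite hst
  -- From here on only the merging properties of the two labellings matter, not their formulas.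
  generalize (fun x => if x ∈ S then f s else f x) = f₁ at h₁
  generalize (fun x => if x ∈ Sᶜ then f t else f x) = f₂ at h₂
  obtain ⟨M₁, hE₁, hr₁, hM₁⟩ := CDIndex.exists_isLabelledBy f₁ (h₁.ne_of_notMem htS htt)
  obtain ⟨M₂, hE₂, hr₂, hM₂⟩ := CDIndex.exists_isLabelledBy f₂
    (h₂.ne_of_notMem (by simpa using hsS) hss)
  have hclass : ∀ e, {g | f g = f e} = (P (f e) : Set (Fin n)) := fun e => by
    ext g
    rw [Finset.mem_coe, hfP]
    rfl
  -- Stated for any merged set `A`, so that it serves both for `S` and for its complement; the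
  -- element `u` ensures that `A` is really a class.
  have hclasses : ∀ (N : Matroid (Fin n)) (f' : Fin n → Fin k) (A : Finset (Fin n)) (u : Fin n),
      N.E = Set.univ → CDIndex.IsLabelledBy N f' → CDIndex.Merges A f f' → u ∈ A →
      CDIndex.parallelClasses N =
        insert (A : Set (Fin n)) ((fun i => (P i : Set (Fin n))) '' {i | ∀ e, f e = i → e ∉ A}) := by
    intro N f' A u hN hL hA hu
    rw [hL.parallelClasses_eq, hN]
    simp only [Set.mem_univ, true_and]
    have hin : ∀ e ∈ A, {g | f' g = f' e} = (A : Set (Fin n)) := fun e he => by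
      ext g
      rw [Set.mem_ofPred, hA.eq_iff, Finset.mem_coe]
      exact ⟨fun h => h.elim (fun h => hA.compat e g h.symm he) And.left, fun h => Or.inr ⟨h, he⟩⟩
    have hout : ∀ e ∉ A, {g | f' g = f' e} = (P (f e) : Set (Fin n)) := fun e he => by
      rw [← hclass]
      ext g
      rw [Set.mem_ofPred, hA.eq_iff]
      exact or_iff_left fun h => he h.2
    ext C
    simp only [Set.mem_ofPred, Set.mem_insert_iff, Set.mem_image]
    constructor
    · rintro ⟨e, rfl⟩
      by_cases he : e ∈ A
      · exact Or.inl (hin e he)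
      · exact Or.inr ⟨f e, fun g hg hgA => he (hA.compat g e hg hgA), (hout e he).symm⟩
    · rintro (rfl | ⟨i, hi, rfl⟩)
      · exact ⟨u, (hin u hu).symm⟩
      · obtain ⟨e, rfl⟩ := hsurj i
        exact ⟨e, (hout e (hi e rfl)).symm⟩
  refine ⟨M₁, M₂, ⟨hE₁, Matroid.loopless_iff_forall_isNonloop.2 hM₁.isNonloop, hr₁, ?_⟩,
    ⟨hE₂, Matroid.loopless_iff_forall_isNonloop.2 hM₂.isNonloop, hr₂, ?_⟩,
    CDIndex.isHyperplaneSplit hM hE hrank hM₁ hE₁ hr₁ hM₂ hE₂ hr₂ h₁ h₂ hsplit, ?_⟩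
  · rw [hclasses M₁ f₁ S s hE₁ hM₁ h₁ hsS]
    congr 2
    ext i
    simp only [Set.mem_ofPred, hmemS]
    refine ⟨fun h => ?_, fun h e he => he ▸ Nat.not_lt.2 h⟩
    obtain ⟨e, he⟩ := hsurj i
    exact Nat.not_lt.1 (he ▸ h e he)
  · rw [hclasses M₂ f₂ Sᶜ t hE₂ hM₂ h₂ (Finset.mem_compl.2 htS), Finset.coe_compl]
    congr 2
    ext i
    simp only [Set.mem_ofPred, Finset.mem_compl, not_not, hmemS]
    refine ⟨fun h => ?_, fun h e he => he ▸ h⟩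
    obtain ⟨e, he⟩ := hsurj i
    exact he ▸ h e he
  · rw [hM.basePolytope_eq hE hrank, hM₁.basePolytope_eq hE₁ hr₁, hM₂.basePolytope_eq hE₂ hr₂,
      hM.splitSubsets_eq hE hcompat]
    exact CDIndex.Psi_pairPolytope_split h₁ h₂ hh hsplit
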